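/- Let $k$ be a field and let $q,s\in k$ satisfy $q\ne 0$, $q^2\neq 1$ and $s^2=q$ (we write $q^{1/2}=s$). Let $U_q(\mathfrak{sl}_2)$ be the Hopf algebra over $k$ generated by $E,F,K,K^{-1}$ with relations $$KK^{-1}=K^{-1}K=1,\quad KE=q^2EK,\quad KF=q^{-2}FK,\quad EF-FE=\frac{K-K^{-1}}{q-q^{-1}},$$ with coproduct $\Delta(E)=1\otimes E+E\otimes K$, $\Delta(F)=K^{-1}\otimes F+F\otimes 1$, $\Delta(K^{\pm1})=K^{\pm1}\otimes K^{\pm1}$, counit $\epsilon(E)=\epsilon(F)=0$, $\epsilon(K^{\pm1})=1$, and antipode $S(E)=-EK^{-1}$, $S(F)=-KF$, $S(K^{\pm1})=K^{\mp1}$. Let $A=k\langle x,y\rangle/(xy-qyx)$ be the $q$-quantum plane, graded by $\deg x=\deg y=1$. (1) There is exactly one $U_q(\mathfrak{sl}_2)$-module algebra structure on $A$ such that $$E\rhd x=y,\quad F\rhd x=0,\quad K^{\pm1}\rhd x=q^{\mp1}x,\qquad E\rhd y=0,\quad F\rhd y=x,\quad K^{\pm1}\rhd y=q^{\pm1}y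 .$$ It preserves the degree, and it is locally nilpotent: for every $a\in A$ there is $n\in\mathbb N$ with $E^n\rhd a=0$. Moreover $A=\bigoplus_{i\in\mathbb Z}A^{(i)}$, where $A^{(i)}$ is the span of the monomials $x^ay^b$ with $b-a=i$; $K$ acts on $A^{(i)}$ by $q^i$, $E\rhd A^{(i)}\subseteq A^{(i+2)}$ and $F\rhd A^{(i)}\subseteq A^{(i-2)}$. (2) The quasitriangular structure $$\mathcal R=q^{H\otimes H/2}\sum_{n\ge 0}\frac{q^{n(n-1)/2}(q-q^{-1})^n}{[n]_q!}\,E^n\otimes F^n,\qquad [n]_q!=\prod_{r=1}^n\frac{q^r-q^{-r}}{q-q^{-1}},$$ which lies in a completion of $U_q(\mathfrak{sl}_2)\otimes U_q(\mathfrak{sl}_2)$, has a well-defined action on $A\otimes A$. Here $q^{H\otimes H/2}$ acts on $A^{(i)}\otimes A^{(j)}$ by the scalar $s^{ij}$, and, if $q$ is a root of unity, the terms with $[n]_q!=0$ are omitted. That is, there is exactly one linear operator on $A\otimes A$ which sends $a\otimes b$, for $a\in A^{(i)}$ and $b\in A^{(j)}$, to the finite sum $\sum_n \frac{q^{n(n-1)/2}(q-q^{-1})^n}{[n]_q!}\,s^{(i+2n)(j-2n)}\,(E^n\rhd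 a)\otimes (F^n\rhd b)$. This operator is invertible. (3) Let $A_{\mathcal R}$ be the Drinfeld twist of $A$ by $\mathcal R$: the vector space $A$ with the product $a\otimes b\mapsto m(\mathcal R^{-1}\rhd (a\otimes b))$, where $m$ is the product of $A$. It is an associative algebra with unit $1_A$. With the grading of $A$ it is a quadratic algebra, i.e. a connected, locally finite-dimensional $\mathbb N$-graded algebra that is generated in degree one, with all relations generated by relations of degree two. It is the $q^{-1}$-quantum plane: there is an isomorphism of algebras $A_{\mathcal R}\cong k\langle x,y\rangle/(xy-q^{-1}yx)$ with $x\mapsto x$ and $y\mapsto y$. -/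

import Mathlib

open scoped TensorProduct

/-! ### The quantized enveloping algebra of `sl₂` -/

/-- Generators of `U_q(sl₂)`. -/
inductive UqGen : Type
  | E | F | K | Kinv

/-- Defining relations of `U_q(sl₂)`:
`K K⁻¹ = K⁻¹ K = 1`, `K E = q² E K`, `K F = q⁻² F K`, `E F - F E = (K - K⁻¹) / (q - q⁻¹)`. -/
inductive UqRel (k : Type*) [Field k] (q : k) :
    FreeAlgebra k UqGen → FreeAlgebra k UqGen → Prop
  | K_Kinv : UqRel k q (FreeAlgebra.ι k UqGen.K * FreeAlgebra.ι k UqGen.Kinv) 1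
  | Kinv_K : UqRel k q (FreeAlgebra.ι k UqGen.Kinv * FreeAlgebra.ι k UqGen.K) 1
  | K_E : UqRel k q (FreeAlgebra.ι k UqGen.K * FreeAlgebra.ι k UqGen.E)
      (q ^ 2 • (FreeAlgebra.ι k UqGen.E * FreeAlgebra.ι k UqGen.K))
  | K_F : UqRel k q (FreeAlgebra.ι k UqGen.K * FreeAlgebra.ι k UqGen.F)
      ((q ^ 2)⁻¹ • (FreeAlgebra.ι k UqGen.F * FreeAlgebra.ι k UqGen.K))
  | E_F : UqRel k q
      (FreeAlgebra.ι k UqGen.E * FreeAlgebra.ι k UqGen.F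
        - FreeAlgebra.ι k UqGen.F * FreeAlgebra.ι k UqGen.E)
      ((q - q⁻¹)⁻¹ • (FreeAlgebra.ι k UqGen.K - FreeAlgebra.ι k UqGen.Kinv))

/-- The algebra `U_q(sl₂)` over `k`. -/
def Uq (k : Type*) [Field k] (q : k) : Type _ := RingQuot (UqRel k q)

namespace Uq

noncomputable instance instRing (k : Type*) [Field k] (q : k) : Ring (Uq k q) :=
  inferInstanceAs (Ring (RingQuot (UqRel k q)))

noncomputable instance instAlgebra (k : Type*) [Field k] (q : k) : Algebra k (Uq k q) :=
  inferInstanceAs (Algebra k (RingQuot (UqRel k q)))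

/-- The class of a generator in `U_q(sl₂)`. -/
noncomputable def gen (k : Type*) [Field k] (q : k) (g : UqGen) : Uq k q :=
  RingQuot.mkAlgHom k (UqRel k q) (FreeAlgebra.ι k g)

/-- The generator `E`. -/
noncomputable abbrev E (k : Type*) [Field k] (q : k) : Uq k q := gen k q UqGen.E
/-- The generator `F`. -/
noncomputable abbrev F (k : Type*) [Field k] (q : k) : Uq k q := gen k q UqGen.F
/-- The generator `K`. -/
noncomputable abbrev K (k : Type*) [Field k] (q : k) : Uq k q := gen k q UqGen.K
/-- The generator `K⁻¹`. -/
noncomputable abbrev Kinv (k : Type*) [Field k] (q : k) : Uq k q := gen k q UqGen.Kinv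

section

variable {k : Type*} [Field k] {q : k}

theorem K_mul_Kinv : K k q * Kinv k q = 1 := by
  have h := RingQuot.mkAlgHom_rel k (UqRel.K_Kinv (k := k) (q := q))
  rw [map_mul, map_one] at h
  exact h

theorem Kinv_mul_K : Kinv k q * K k q = 1 := by
  have h := RingQuot.mkAlgHom_rel k (UqRel.Kinv_K (k := k) (q := q))
  rw [map_mul, map_one] at h
  exact h

theorem K_mul_E : K k q * E k q = q ^ 2 • (E k q * K k q) := by
  have h := RingQuot.mkAlgHom_rel k (UqRel.K_E (k := k) (q := q))
  rw [map_smul, map_mul, map_mul] at h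
  exact h

theorem K_mul_F : K k q * F k q = (q ^ 2)⁻¹ • (F k q * K k q) := by
  have h := RingQuot.mkAlgHom_rel k (UqRel.K_F (k := k) (q := q))
  rw [map_smul, map_mul, map_mul] at h
  exact h

theorem E_F : E k q * F k q - F k q * E k q = (q - q⁻¹)⁻¹ • (K k q - Kinv k q) := by
  have h := RingQuot.mkAlgHom_rel k (UqRel.E_F (k := k) (q := q))
  rw [map_smul, map_sub, map_sub, map_mul, map_mul] at h
  exact h

/-- An assignment of the generators that satisfies the relations extends to `U_q(sl₂)`. -/
noncomputable def lift {B : Type*} [Ring B] [Algebra k B] (f : UqGen → B)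
    (h1 : f .K * f .Kinv = 1) (h2 : f .Kinv * f .K = 1)
    (h3 : f .K * f .E = q ^ 2 • (f .E * f .K))
    (h4 : f .K * f .F = (q ^ 2)⁻¹ • (f .F * f .K))
    (h5 : f .E * f .F - f .F * f .E = (q - q⁻¹)⁻¹ • (f .K - f .Kinv)) :
    Uq k q →ₐ[k] B :=
  RingQuot.liftAlgHom k ⟨FreeAlgebra.lift k f, by
    intro x y hxy
    cases hxy <;> simp [h1, h2, h3, h4, h5]⟩

@[simp]
theorem lift_gen {B : Type*} [Ring B] [Algebra k B] (f : UqGen → B) (h1 h2 h3 h4 h5)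
    (g : UqGen) : lift (q := q) f h1 h2 h3 h4 h5 (gen k q g) = f g := by
  unfold lift gen
  erw [RingQuot.liftAlgHom_mkAlgHom_apply]
  simp

theorem algHom_ext {B : Type*} [Semiring B] [Algebra k B] {f g : Uq k q →ₐ[k] B}
    (h : ∀ x, f (gen k q x) = g (gen k q x)) : f = g := by
  apply RingQuot.ringQuot_ext'
  apply FreeAlgebra.hom_ext
  funext x
  exact h x

theorem induction {P : Uq k q → Prop} (hc : ∀ c : k, P (algebraMap k _ c))
    (hg : ∀ g, P (gen k q g)) (hm : ∀ a b, P a → P b → P (a * b))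
    (ha : ∀ a b, P a → P b → P (a + b)) (u : Uq k q) : P u := by
  obtain ⟨v, rfl⟩ := RingQuot.mkAlgHom_surjective k (UqRel k q) u
  induction v with
  | grade0 c => rw [AlgHom.commutes]; exact hc c
  | grade1 g => exact hg g
  | mul a b h1 h2 => rw [map_mul]; exact hm _ _ h1 h2
  | add a b h1 h2 => rw [map_add]; exact ha _ _ h1 h2

theorem E_mul_Kinv : E k q * Kinv k q = q ^ 2 • (Kinv k q * E k q) := by
  have h : Kinv k q * (K k q * E k q) * Kinv k q
      = q ^ 2 • (Kinv k q * (E k q * (K k q * Kinv k q))) := by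
    rw [K_mul_E]; simp [mul_assoc]
  rw [← mul_assoc, Kinv_mul_K, one_mul, K_mul_Kinv, mul_one] at h
  exact h

theorem F_mul_Kinv : F k q * Kinv k q = (q ^ 2)⁻¹ • (Kinv k q * F k q) := by
  have h : Kinv k q * (K k q * F k q) * Kinv k q
      = (q ^ 2)⁻¹ • (Kinv k q * (F k q * (K k q * Kinv k q))) := by
    rw [K_mul_F]; simp [mul_assoc]
  rw [← mul_assoc, Kinv_mul_K, one_mul, K_mul_Kinv, mul_one] at h
  exact h

theorem E_eq_zero (hq : q = 0) : E k q = 0 := by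
  have h : Kinv k q * (K k q * E k q) = 0 := by rw [K_mul_E, hq]; simp
  rwa [← mul_assoc, Kinv_mul_K, one_mul] at h

/-- The coproduct on generators:
`Δ E = 1 ⊗ E + E ⊗ K`, `Δ F = K⁻¹ ⊗ F + F ⊗ 1`, `Δ K^{±1} = K^{±1} ⊗ K^{±1}`. -/
noncomputable def comulGen (k : Type*) [Field k] (q : k) : UqGen → Uq k q ⊗[k] Uq k q
  | .E => 1 ⊗ₜ[k] E k q + E k q ⊗ₜ[k] K k q
  | .F => Kinv k q ⊗ₜ[k] F k q + F k q ⊗ₜ[k] 1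
  | .K => K k q ⊗ₜ[k] K k q
  | .Kinv => Kinv k q ⊗ₜ[k] Kinv k q

/-- The counit on generators: `ε E = ε F = 0`, `ε K^{±1} = 1`. -/
def counitGen (k : Type*) [Field k] : UqGen → k
  | .E => 0
  | .F => 0
  | .K => 1
  | .Kinv => 1

/-- The antipode on generators: `S E = -E K⁻¹`, `S F = -K F`, `S K^{±1} = K^{∓1}`. -/
noncomputable def antipodeGen (k : Type*) [Field k] (q : k) : UqGen → Uq k q
  | .E => -(E k q * Kinv k q)
  | .F => -(K k q * F k q)
  | .K => Kinv k q
  | .Kinv => K k q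

/-- The coproduct of `U_q(sl₂)`. -/
noncomputable def comulHom (k : Type*) [Field k] (q : k) : Uq k q →ₐ[k] Uq k q ⊗[k] Uq k q :=
  lift (comulGen k q)
    (by simp [comulGen, K_mul_Kinv, Algebra.TensorProduct.one_def])
    (by simp [comulGen, Kinv_mul_K, Algebra.TensorProduct.one_def])
    (by
      simp only [comulGen, mul_add, add_mul, Algebra.TensorProduct.tmul_mul_tmul, one_mul, mul_one,
        K_mul_E, TensorProduct.tmul_smul, TensorProduct.smul_tmul', smul_add])
    (by
      simp only [comulGen, mul_add, add_mul, Algebra.TensorProduct.tmul_mul_tmul, one_mul, mul_one,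
        K_mul_F, TensorProduct.tmul_smul, TensorProduct.smul_tmul', smul_add, K_mul_Kinv,
        Kinv_mul_K])
    (by
      have key : (E k q * Kinv k q) ⊗ₜ[k] (K k q * F k q)
          = (Kinv k q * E k q) ⊗ₜ[k] (F k q * K k q) := by
        by_cases hq : q = 0
        · simp [E_eq_zero hq]
        · rw [E_mul_Kinv, K_mul_F, TensorProduct.smul_tmul, smul_smul,
            mul_inv_cancel₀ (pow_ne_zero 2 hq), one_smul]
      have e1 : E k q * F k q = F k q * E k q + (q - q⁻¹)⁻¹ • (K k q - Kinv k q) := by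
        rw [← E_F]; abel
      simp only [comulGen, mul_add, add_mul, Algebra.TensorProduct.tmul_mul_tmul, one_mul, mul_one,
        key, e1, TensorProduct.tmul_add, TensorProduct.add_tmul, TensorProduct.tmul_smul,
        TensorProduct.smul_tmul', TensorProduct.tmul_sub, TensorProduct.sub_tmul, smul_sub]
      abel)

/-- The counit of `U_q(sl₂)`. -/
noncomputable def counitHom (k : Type*) [Field k] (q : k) : Uq k q →ₐ[k] k :=
  lift (counitGen k) (by simp [counitGen]) (by simp [counitGen]) (by simp [counitGen])
    (by simp [counitGen]) (by simp [counitGen])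

/-- The antipode of `U_q(sl₂)` as an algebra homomorphism to the opposite algebra. -/
noncomputable def antipodeHom (k : Type*) [Field k] (q : k) : Uq k q →ₐ[k] (Uq k q)ᵐᵒᵖ :=
  lift (fun g => MulOpposite.op (antipodeGen k q g))
    (by simp [antipodeGen, ← MulOpposite.op_mul, K_mul_Kinv])
    (by simp [antipodeGen, ← MulOpposite.op_mul, Kinv_mul_K])
    (by
      rw [← MulOpposite.op_mul, ← MulOpposite.op_mul, ← MulOpposite.op_smul]
      congr 1
      simp only [antipodeGen, neg_mul, mul_neg, smul_neg]
      rw [E_mul_Kinv]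
      simp only [smul_mul_assoc, mul_smul_comm, mul_assoc]
      rw [E_mul_Kinv]
      simp only [mul_smul_comm])
    (by
      rw [← MulOpposite.op_mul, ← MulOpposite.op_mul, ← MulOpposite.op_smul]
      congr 1
      simp only [antipodeGen, neg_mul, mul_neg, smul_neg]
      rw [← mul_assoc, Kinv_mul_K, one_mul, mul_assoc, F_mul_Kinv, mul_smul_comm, ← mul_assoc,
        K_mul_Kinv, one_mul])
    (by
      simp only [← MulOpposite.op_mul, ← MulOpposite.op_sub, ← MulOpposite.op_smul]
      congr 1
      simp only [antipodeGen, neg_mul, mul_neg, neg_neg]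
      have a1 : K k q * F k q * (E k q * Kinv k q) = F k q * E k q := by
        by_cases hq : q = 0
        · simp [E_eq_zero hq]
        · rw [E_mul_Kinv, K_mul_F]
          simp only [smul_mul_assoc, mul_smul_comm, smul_smul]
          rw [mul_inv_cancel₀ (pow_ne_zero 2 hq), one_smul, mul_assoc, ← mul_assoc (K k q),
            K_mul_Kinv, one_mul]
      have a2 : E k q * Kinv k q * (K k q * F k q) = E k q * F k q := by
        rw [mul_assoc, ← mul_assoc (Kinv k q), Kinv_mul_K, one_mul]
      rw [a1, a2, ← neg_sub, E_F, ← smul_neg, neg_sub])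

noncomputable instance instBialgebra (k : Type*) [Field k] (q : k) : Bialgebra k (Uq k q) :=
  Bialgebra.ofAlgHom (comulHom k q) (counitHom k q)
    (by
      apply algHom_ext
      intro g
      cases g <;>
        simp [comulHom, comulGen, TensorProduct.tmul_add, TensorProduct.add_tmul, add_assoc,
          Algebra.TensorProduct.one_def])
    (by
      apply algHom_ext
      intro g
      cases g <;> simp [comulHom, comulGen, counitHom, counitGen])
    (by
      apply algHom_ext
      intro g
      cases g <;> simp [comulHom, comulGen, counitHom, counitGen])

/-- The antipode of `U_q(sl₂)` as a linear map. -/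
noncomputable def antipodeLin (k : Type*) [Field k] (q : k) : Uq k q →ₗ[k] Uq k q :=
  (MulOpposite.opLinearEquiv k).symm.toLinearMap ∘ₗ (antipodeHom k q).toLinearMap

theorem antipodeLin_gen (g : UqGen) : antipodeLin k q (gen k q g) = antipodeGen k q g := by
  simp [antipodeLin, antipodeHom]

theorem antipodeLin_one : antipodeLin k q 1 = 1 := by
  simp [antipodeLin]

theorem antipodeLin_mul (a b : Uq k q) :
    antipodeLin k q (a * b) = antipodeLin k q b * antipodeLin k q a := by
  simp [antipodeLin]

theorem comul_gen (g : UqGen) : Coalgebra.comul (R := k) (gen k q g) = comulGen k q g :=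
  lift_gen _ _ _ _ _ _ _

theorem counit_gen (g : UqGen) : Coalgebra.counit (R := k) (gen k q g) = counitGen k g :=
  lift_gen _ _ _ _ _ _ _

theorem antipode_left (u : Uq k q) :
    LinearMap.mul' k (Uq k q) ((antipodeLin k q).rTensor (Uq k q) (Coalgebra.comul u))
      = algebraMap k _ (Coalgebra.counit (R := k) u) := by
  induction u using Uq.induction with
  | hc c => simp [antipodeLin_one, Algebra.TensorProduct.one_def, Algebra.algebraMap_eq_smul_one]
  | hg g =>
    rw [comul_gen, counit_gen]
    cases g <;>
      simp [comulGen, counitGen, antipodeLin_gen, antipodeLin_one, antipodeGen, mul_assoc,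
        Kinv_mul_K, K_mul_Kinv]
  | hm a b ha hb =>
    have key : ∀ w t : Uq k q ⊗[k] Uq k q, ∀ c : k,
        LinearMap.mul' k (Uq k q) ((antipodeLin k q).rTensor (Uq k q) w) = algebraMap k _ c →
        LinearMap.mul' k (Uq k q) ((antipodeLin k q).rTensor (Uq k q) (w * t))
          = c • LinearMap.mul' k (Uq k q) ((antipodeLin k q).rTensor (Uq k q) t) := by
      intro w t c hw
      induction t with
      | zero => simp
      | add t1 t2 h1 h2 => rw [mul_add, map_add, map_add, h1, h2, map_add, map_add, smul_add]
      | tmul x y =>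
        have : LinearMap.mul' k (Uq k q) ((antipodeLin k q).rTensor (Uq k q) (w * x ⊗ₜ[k] y))
            = antipodeLin k q x *
              LinearMap.mul' k (Uq k q) ((antipodeLin k q).rTensor (Uq k q) w) * y := by
          clear hw
          induction w with
          | zero => simp
          | add t1 t2 h1 h2 => rw [add_mul, map_add, map_add, h1, h2, map_add, map_add, mul_add,
              add_mul]
          | tmul x' y' => simp [antipodeLin_mul, mul_assoc]
        rw [this, hw]
        simp [Algebra.algebraMap_eq_smul_one]
    rw [Bialgebra.comul_mul, key _ _ _ ha, hb, Bialgebra.counit_mul, map_mul, Algebra.smul_def]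
  | ha a b ha hb => simp only [map_add, ha, hb]

theorem antipode_right (u : Uq k q) :
    LinearMap.mul' k (Uq k q) ((antipodeLin k q).lTensor (Uq k q) (Coalgebra.comul u))
      = algebraMap k _ (Coalgebra.counit (R := k) u) := by
  induction u using Uq.induction with
  | hc c => simp [antipodeLin_one, Algebra.TensorProduct.one_def, Algebra.algebraMap_eq_smul_one]
  | hg g =>
    rw [comul_gen, counit_gen]
    cases g <;>
      simp [comulGen, counitGen, antipodeLin_gen, antipodeLin_one, antipodeGen, ← mul_assoc,
        Kinv_mul_K, K_mul_Kinv]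
  | hm a b ha hb =>
    have key : ∀ w t : Uq k q ⊗[k] Uq k q, ∀ c : k,
        LinearMap.mul' k (Uq k q) ((antipodeLin k q).lTensor (Uq k q) w) = algebraMap k _ c →
        LinearMap.mul' k (Uq k q) ((antipodeLin k q).lTensor (Uq k q) (t * w))
          = c • LinearMap.mul' k (Uq k q) ((antipodeLin k q).lTensor (Uq k q) t) := by
      intro w t c hw
      induction t with
      | zero => simp
      | add t1 t2 h1 h2 => rw [add_mul, map_add, map_add, h1, h2, map_add, map_add, smul_add]
      | tmul x y =>
        have : LinearMap.mul' k (Uq k q) ((antipodeLin k q).lTensor (Uq k q) (x ⊗ₜ[k] y * w))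
            = x * LinearMap.mul' k (Uq k q) ((antipodeLin k q).lTensor (Uq k q) w) *
              antipodeLin k q y := by
          clear hw
          induction w with
          | zero => simp
          | add t1 t2 h1 h2 => rw [mul_add, map_add, map_add, h1, h2, map_add, map_add, mul_add,
              add_mul]
          | tmul x' y' => simp [antipodeLin_mul, mul_assoc]
        rw [this, hw]
        simp [Algebra.algebraMap_eq_smul_one]
    rw [Bialgebra.comul_mul, key _ _ _ hb, ha, Bialgebra.counit_mul, map_mul, Algebra.smul_def]
    exact Algebra.commutes _ _
  | ha a b ha hb => simp only [map_add, ha, hb]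

/-- The Hopf algebra `U_q(sl₂)`. -/
noncomputable instance instHopfAlgebra (k : Type*) [Field k] (q : k) :
    HopfAlgebra k (Uq k q) where
  antipode := antipodeLin k q
  mul_antipode_rTensor_comul := LinearMap.ext antipode_left
  mul_antipode_lTensor_comul := LinearMap.ext antipode_right

end

end Uq

/-! ### Module algebras -/

/-- The action of `H ⊗ H` on `M ⊗ N` for two representations of an algebra `H`. -/
noncomputable def tensorAction {k H M N : Type*} [Field k] [Ring H] [Algebra k H]
    [AddCommGroup M] [Module k M] [AddCommGroup N] [Module k N]
    (ρ : H →ₐ[k] Module.End k M) (ρ' : H →ₐ[k] Module.End k N) :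
    H ⊗[k] H →ₐ[k] Module.End k (M ⊗[k] N) :=
  (Module.endTensorEndAlgHom (R := k) (S := k) (A := k)).comp (Algebra.TensorProduct.map ρ ρ')

/-- The representation `ρ` of the bialgebra `H` makes the algebra `A` an `H`-module algebra:
`h ▷ (a b) = m (Δ(h) ▷ (a ⊗ b))` and `h ▷ 1 = ε(h) 1`. -/
structure IsModuleAlgebra {k H A : Type*} [Field k] [Ring H] [Bialgebra k H] [Ring A]
    [Algebra k A] (ρ : H →ₐ[k] Module.End k A) : Prop where
  act_mul : ∀ (h : H) (a b : A), ρ h (a * b)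
    = LinearMap.mul' k A (tensorAction ρ ρ (Coalgebra.comul (R := k) h) (a ⊗ₜ[k] b))
  act_one : ∀ h : H, ρ h 1 = algebraMap k A (Coalgebra.counit (R := k) h)

/-! ### Quadratic algebras -/

/-- The `k`-algebra `A` with the family of subspaces `𝒜` is a quadratic algebra: a connected,
locally finite-dimensional `ℕ`-graded algebra which is generated by `V = 𝒜 1` and for which the
kernel of `T(V) → A` is the two-sided ideal generated by a set of relations in `V ⊗ V`. -/
structure IsQuadraticAlgebra (k : Type*) {A : Type*} [Field k] [Ring A] [Algebra k A]
    (𝒜 : ℕ → Submodule k A) : Prop where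
  nontrivial : Nontrivial A
  connected : 𝒜 0 = 1
  mul_mem : ∀ (i j : ℕ) (a b : A), a ∈ 𝒜 i → b ∈ 𝒜 j → a * b ∈ 𝒜 (i + j)
  isInternal : DirectSum.IsInternal 𝒜
  finiteDimensional : ∀ n, FiniteDimensional k (𝒜 n)
  generated : Function.Surjective (TensorAlgebra.lift k (𝒜 1).subtype)
  relations : ∃ R : Submodule k (TensorAlgebra k (𝒜 1)),
    R ≤ (LinearMap.range (TensorAlgebra.ι k (M := 𝒜 1))) ^ 2 ∧
    ∀ t, TensorAlgebra.lift k (𝒜 1).subtype t = 0 ↔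
      t ∈ TwoSidedIdeal.span (R : Set (TensorAlgebra k (𝒜 1)))

/-! ### The quantum plane -/

/-- Generators of the quantum plane. -/
inductive PlaneGen : Type
  | x | y

/-- The defining relation `x y = q y x` of the `q`-quantum plane. -/
inductive QuantumPlaneRel (k : Type*) [Field k] (q : k) :
    FreeAlgebra k PlaneGen → FreeAlgebra k PlaneGen → Prop
  | x_y : QuantumPlaneRel k q (FreeAlgebra.ι k PlaneGen.x * FreeAlgebra.ι k PlaneGen.y)
      (q • (FreeAlgebra.ι k PlaneGen.y * FreeAlgebra.ι k PlaneGen.x))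

/-- The `q`-quantum plane `k⟨x, y⟩ / (x y - q y x)`. -/
def QuantumPlane (k : Type*) [Field k] (q : k) : Type _ := RingQuot (QuantumPlaneRel k q)

namespace QuantumPlane

noncomputable instance instRing (k : Type*) [Field k] (q : k) : Ring (QuantumPlane k q) :=
  inferInstanceAs (Ring (RingQuot (QuantumPlaneRel k q)))

noncomputable instance instAlgebra (k : Type*) [Field k] (q : k) :
    Algebra k (QuantumPlane k q) :=
  inferInstanceAs (Algebra k (RingQuot (QuantumPlaneRel k q)))

/-- The generator `x`. -/
noncomputable def x (k : Type*) [Field k] (q : k) : QuantumPlane k q :=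
  RingQuot.mkAlgHom k (QuantumPlaneRel k q) (FreeAlgebra.ι k PlaneGen.x)

/-- The generator `y`. -/
noncomputable def y (k : Type*) [Field k] (q : k) : QuantumPlane k q :=
  RingQuot.mkAlgHom k (QuantumPlaneRel k q) (FreeAlgebra.ι k PlaneGen.y)

/-- The homogeneous component of degree `n`: the span of the products of `n` generators. -/
noncomputable def degreePart (k : Type*) [Field k] (q : k) (n : ℕ) :
    Submodule k (QuantumPlane k q) :=
  (Submodule.span k {x k q, y k q}) ^ n

/-- The weight space of weight `i`, where `x` has weight `-1` and `y` has weight `1`. -/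
noncomputable def weightPart (k : Type*) [Field k] (q : k) (i : ℤ) :
    Submodule k (QuantumPlane k q) :=
  Submodule.span k {v | ∃ a b : ℕ, (b : ℤ) - (a : ℤ) = i ∧ v = x k q ^ a * y k q ^ b}

end QuantumPlane

/-- `ρ` makes the `q`-quantum plane a `U_q(sl₂)`-module algebra, and on the generators it is the
vector representation of `U_q(sl₂)`, with highest weight vector `y`:
`E ▷ y = 0`, `F ▷ y = x`, `K^{±1} ▷ y = q^{±1} y`,
`E ▷ x = y`, `F ▷ x = 0`, `K^{±1} ▷ x = q^{∓1} x`. -/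
structure IsPlaneAction {k : Type*} [Field k] {q : k}
    (ρ : Uq k q →ₐ[k] Module.End k (QuantumPlane k q)) : Prop where
  isModuleAlgebra : IsModuleAlgebra ρ
  E_y : ρ (Uq.E k q) (QuantumPlane.y k q) = 0
  F_y : ρ (Uq.F k q) (QuantumPlane.y k q) = QuantumPlane.x k q
  K_y : ρ (Uq.K k q) (QuantumPlane.y k q) = q • QuantumPlane.y k q
  Kinv_y : ρ (Uq.Kinv k q) (QuantumPlane.y k q) = q⁻¹ • QuantumPlane.y k q
  E_x : ρ (Uq.E k q) (QuantumPlane.x k q) = QuantumPlane.y k q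
  F_x : ρ (Uq.F k q) (QuantumPlane.x k q) = 0
  K_x : ρ (Uq.K k q) (QuantumPlane.x k q) = q⁻¹ • QuantumPlane.x k q
  Kinv_x : ρ (Uq.Kinv k q) (QuantumPlane.x k q) = q • QuantumPlane.x k q

/-! ### The universal R-matrix -/

/-- A representation of `U_q(sl₂)` is locally nilpotent if every vector is killed by a power
of `E`. -/
def IsLocallyNilpotent {k M : Type*} [Field k] [AddCommGroup M] [Module k M] {q : k}
    (ρ : Uq k q →ₐ[k] Module.End k M) : Prop :=
  ∀ m : M, ∃ n : ℕ, ρ (Uq.E k q ^ n) m = 0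

/-- `W` is a decomposition of a representation of `U_q(sl₂)` into integral weight spaces.
When `q` is not a root of unity, `W i` is necessarily the `q ^ i`-eigenspace of `K`. -/
structure IsWeightDecomposition {k M : Type*} [Field k] [AddCommGroup M] [Module k M] {q : k}
    (ρ : Uq k q →ₐ[k] Module.End k M) (W : ℤ → Submodule k M) : Prop where
  isInternal : DirectSum.IsInternal W
  K_act : ∀ i, ∀ m ∈ W i, ρ (Uq.K k q) m = q ^ i • m
  E_act : ∀ i, ∀ m ∈ W i, ρ (Uq.E k q) m ∈ W (i + 2)
  F_act : ∀ i, ∀ m ∈ W i, ρ (Uq.F k q) m ∈ W (i - 2)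

/-- The `q`-number `[n]_q = (q ^ n - q ^ (-n)) / (q - q ^ (-1))`. -/
def qNumber {k : Type*} [Field k] (q : k) (n : ℕ) : k :=
  (q ^ n - (q ^ n)⁻¹) / (q - q⁻¹)

/-- The `q`-factorial `[n]_q! = [1]_q [2]_q ⋯ [n]_q`. -/
def qFactorial {k : Type*} [Field k] (q : k) (n : ℕ) : k :=
  ∏ r ∈ Finset.range n, qNumber q (r + 1)

/-- The coefficient `q ^ (n (n - 1) / 2) (q - q⁻¹) ^ n / [n]_q!` of `E ^ n ⊗ F ^ n` in the
universal R-matrix. If `[n]_q! = 0` (which happens only if `q` is a root of unity), then this is a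
division by zero with value `0`: the term is left out. -/
def rMatrixCoeff {k : Type*} [Field k] (q : k) (n : ℕ) : k :=
  q ^ (n * (n - 1) / 2) * (q - q⁻¹) ^ n / qFactorial q n

/-- `T` is the action on `M ⊗ N` of the quasitriangular structure
`R = q ^ (H ⊗ H / 2) ∑ₙ q ^ (n (n - 1) / 2) (q - q⁻¹) ^ n / [n]_q! E ^ n ⊗ F ^ n`
in the completion of `U_q(sl₂) ⊗ U_q(sl₂)`. Here `s` is a square root of `q`, and
`q ^ (H ⊗ H / 2)` is multiplication by `s ^ (i j)` on vectors of weight `(i, j)`. On `m ⊗ n` the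
sum is finite as soon as a power of `E` kills `m`; it may then be cut off at any such power. -/
def IsRMatrixAction {k M N : Type*} [Field k] [AddCommGroup M] [Module k M]
    [AddCommGroup N] [Module k N] {q : k} (s : k)
    (ρ : Uq k q →ₐ[k] Module.End k M) (W : ℤ → Submodule k M)
    (ρ' : Uq k q →ₐ[k] Module.End k N) (W' : ℤ → Submodule k N)
    (T : M ⊗[k] N →ₗ[k] M ⊗[k] N) : Prop :=
  ∀ (i j : ℤ), ∀ m ∈ W i, ∀ n ∈ W' j, ∀ L : ℕ, ρ (Uq.E k q ^ L) m = 0 →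
    T (m ⊗ₜ[k] n) = ∑ r ∈ Finset.range L,
      (rMatrixCoeff q r * s ^ ((i + 2 * r) * (j - 2 * r))) •
        (ρ (Uq.E k q ^ r) m ⊗ₜ[k] ρ' (Uq.F k q ^ r) n)

/-! ### Drinfeld twists -/

/-- The twisted product `a ⊗ b ↦ m (T⁻¹ (a ⊗ b))` on `A`, where the invertible operator `T` is the
action of the twisting element on `A ⊗ A`. -/
noncomputable def twistMul {k A : Type*} [Field k] [Ring A] [Algebra k A]
    (T : (A ⊗[k] A) ≃ₗ[k] (A ⊗[k] A)) (a b : A) : A :=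
  LinearMap.mul' k A (T.symm (a ⊗ₜ[k] b))

/-- The twisted product is associative, with the same unit as `A`. -/
structure IsTwisting {k A : Type*} [Field k] [Ring A] [Algebra k A]
    (T : (A ⊗[k] A) ≃ₗ[k] (A ⊗[k] A)) : Prop where
  assoc : ∀ a b c, twistMul T (twistMul T a b) c = twistMul T a (twistMul T b c)
  one_mul : ∀ a, twistMul T 1 a = a
  mul_one : ∀ a, twistMul T a 1 = a

/-- The Drinfeld twist of `A`: the vector space `A` with the twisted product. -/
def DrinfeldTwist {k A : Type*} [Field k] [Ring A] [Algebra k A]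
    (T : (A ⊗[k] A) ≃ₗ[k] (A ⊗[k] A)) (_hT : IsTwisting T) : Type _ := A

namespace DrinfeldTwist

noncomputable instance instAddCommGroup {k A : Type*} [Field k] [Ring A] [Algebra k A]
    (T : (A ⊗[k] A) ≃ₗ[k] (A ⊗[k] A)) (hT : IsTwisting T) : AddCommGroup (DrinfeldTwist T hT) :=
  inferInstanceAs (AddCommGroup A)

noncomputable instance instModule {k A : Type*} [Field k] [Ring A] [Algebra k A]
    (T : (A ⊗[k] A) ≃ₗ[k] (A ⊗[k] A)) (hT : IsTwisting T) : Module k (DrinfeldTwist T hT) :=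
  inferInstanceAs (Module k A)

/-- The identity map `A → A_T` of the underlying vector spaces. -/
noncomputable def of {k A : Type*} [Field k] [Ring A] [Algebra k A]
    (T : (A ⊗[k] A) ≃ₗ[k] (A ⊗[k] A)) (hT : IsTwisting T) : A ≃ₗ[k] DrinfeldTwist T hT :=
  LinearEquiv.refl k A

noncomputable instance instRing {k A : Type*} [Field k] [Ring A] [Algebra k A]
    (T : (A ⊗[k] A) ≃ₗ[k] (A ⊗[k] A)) (hT : IsTwisting T) : Ring (DrinfeldTwist T hT) :=
  { instAddCommGroup T hT with
    mul := fun a b => of T hT (twistMul T ((of T hT).symm a) ((of T hT).symm b))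
    one := of T hT 1
    mul_assoc := hT.assoc
    one_mul := hT.one_mul
    mul_one := hT.mul_one
    zero_mul := fun a => by
      change of T hT (twistMul T ((of T hT).symm 0) ((of T hT).symm a)) = 0
      simp [twistMul]
    mul_zero := fun a => by
      change of T hT (twistMul T ((of T hT).symm a) ((of T hT).symm 0)) = 0
      simp [twistMul]
    left_distrib := fun a b c => by
      change of T hT (twistMul T ((of T hT).symm a) ((of T hT).symm (b + c)))
        = of T hT (twistMul T ((of T hT).symm a) ((of T hT).symm b))
          + of T hT (twistMul T ((of T hT).symm a) ((of T hT).symm c))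
      simp [twistMul, TensorProduct.tmul_add]
    right_distrib := fun a b c => by
      change of T hT (twistMul T ((of T hT).symm (a + b)) ((of T hT).symm c))
        = of T hT (twistMul T ((of T hT).symm a) ((of T hT).symm c))
          + of T hT (twistMul T ((of T hT).symm b) ((of T hT).symm c))
      simp [twistMul, TensorProduct.add_tmul] }

noncomputable instance instAlgebra {k A : Type*} [Field k] [Ring A] [Algebra k A]
    (T : (A ⊗[k] A) ≃ₗ[k] (A ⊗[k] A)) (hT : IsTwisting T) : Algebra k (DrinfeldTwist T hT) :=
  Algebra.ofModule
    (fun r a b => by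
      change of T hT (twistMul T ((of T hT).symm (r • a)) ((of T hT).symm b))
        = r • of T hT (twistMul T ((of T hT).symm a) ((of T hT).symm b))
      simp [twistMul, ← TensorProduct.smul_tmul'])
    (fun r a b => by
      change of T hT (twistMul T ((of T hT).symm a) ((of T hT).symm (r • b)))
        = r • of T hT (twistMul T ((of T hT).symm a) ((of T hT).symm b))
      simp [twistMul])

theorem of_mul_of {k A : Type*} [Field k] [Ring A] [Algebra k A]
    (T : (A ⊗[k] A) ≃ₗ[k] (A ⊗[k] A)) (hT : IsTwisting T) (a b : A) :
    of T hT a * of T hT b = of T hT (LinearMap.mul' k A (T.symm (a ⊗ₜ[k] b))) := rfl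

theorem of_one {k A : Type*} [Field k] [Ring A] [Algebra k A]
    (T : (A ⊗[k] A) ≃ₗ[k] (A ⊗[k] A)) (hT : IsTwisting T) :
    of T hT (1 : A) = 1 := rfl

end DrinfeldTwist

/-!
The monomials `y ^ b x ^ a` form a basis of the `q`-plane `A`; they are linearly independent because
the regular representation can be written down on the free vector space on pairs `(a, b)`
(`QuantumPlane.basis`). In this basis, `E`, `F` and `K` act by
`[a]_q y ^ (b + 1) x ^ (a - 1)`, `[b]_q y ^ (b - 1) x ^ (a + 1)` and `q ^ (b - a) y ^ b x ^ a`.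
The relations of `U_q(sl₂)` and the product rule then reduce to identities between `q`-numbers, and
the weights, the degrees and the local nilpotency of `E` can be read off. Uniqueness of the action
holds because the product rule determines it from its values on `x` and `y`.

On products of two basis vectors, the R-matrix is a diagonal operator with entries `s ^ (i j)` plus
terms that lower the exponent `a` of the first factor. So it is bijective, by the general fact
`Module.Basis.bijective_of_triangular` about triangular operators on infinite-dimensional spaces.

For the twist, neither the hexagon identities nor the Yang-Baxter equation is used. Instead, `A` is
identified with the `q⁻¹`-plane `B` by the rescaling `φ` of the monomial of degree `n` and weight
`i` by `s ^ ((i ^ 2 - n) / 2)`, and it is shown that `φ ∘ m_A = m_B ∘ (φ ⊗ φ) ∘ R`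
(`QuantumPlane.rescale_mul'`). On a pair of monomials, the rescaling cancels the powers of `s`, and
what remains is the `q`-binomial theorem `sum_qBinomial_mul_qFalling`:
`q ^ (a d) = ∑ r, q ^ (r (r - 1) / 2) (q - q⁻¹) ^ r / [r]! [a]_r [d]_r q ^ (-(a - r) (d - r))`,
where `[a]_r` is the falling `q`-factorial. At a root of unity, `[a]_r / [r]!` is read as
a `q`-binomial coefficient; the terms with `[r]! = 0`, which the R-matrix omits, vanish there as
well, since `[d]_r` is a multiple of `[r]!`. Hence `φ` carries the product `m_A ∘ R⁻¹` to the
product of `B`, which makes it associative and unital, and quadratic because `B` is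
(`QuantumPlane.isQuadraticAlgebra_of_algEquiv`).
-/

/-! ### The monomial basis of the quantum plane -/

namespace QuantumPlane

section

variable {k : Type*} [Field k] {q : k}

theorem x_mul_y : x k q * y k q = q • (y k q * x k q) := by
  have h := RingQuot.mkAlgHom_rel k (QuantumPlaneRel.x_y (k := k) (q := q))
  rw [map_smul, map_mul, map_mul] at h
  exact h

/-- A pair of elements that satisfies the relation of the `q`-quantum plane defines an algebra
homomorphism. -/
noncomputable def lift {B : Type*} [Ring B] [Algebra k B] (X Y : B) (h : X * Y = q • (Y * X)) :
    QuantumPlane k q →ₐ[k] B :=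
  RingQuot.liftAlgHom k ⟨FreeAlgebra.lift k (fun g => PlaneGen.casesOn g X Y), by
    intro u v huv
    cases huv
    simpa using h⟩

@[simp]
theorem lift_x {B : Type*} [Ring B] [Algebra k B] (X Y : B) (h : X * Y = q • (Y * X)) :
    lift X Y h (x k q) = X := by
  unfold lift x
  erw [RingQuot.liftAlgHom_mkAlgHom_apply]
  simp

@[simp]
theorem lift_y {B : Type*} [Ring B] [Algebra k B] (X Y : B) (h : X * Y = q • (Y * X)) :
    lift X Y h (y k q) = Y := by
  unfold lift y
  erw [RingQuot.liftAlgHom_mkAlgHom_apply]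
  simp

theorem induction {P : QuantumPlane k q → Prop} (hc : ∀ c : k, P (algebraMap k _ c))
    (hx : P (x k q)) (hy : P (y k q)) (hm : ∀ a b, P a → P b → P (a * b))
    (ha : ∀ a b, P a → P b → P (a + b)) (u : QuantumPlane k q) : P u := by
  obtain ⟨v, rfl⟩ := RingQuot.mkAlgHom_surjective k (QuantumPlaneRel k q) u
  induction v with
  | grade0 c => rw [AlgHom.commutes]; exact hc c
  | grade1 g => cases g; exacts [hx, hy]
  | mul a b h1 h2 => rw [map_mul]; exact hm _ _ h1 h2
  | add a b h1 h2 => rw [map_add]; exact ha _ _ h1 h2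

/-- The ordered monomial `y ^ b x ^ a`, with exponents `p = (a, b)`. In this order of the
generators, the action of `U_q(sl₂)` has no powers of `q` besides the `q`-numbers. -/
noncomputable def monomial (k : Type*) [Field k] (q : k) (p : ℕ × ℕ) : QuantumPlane k q :=
  y k q ^ p.2 * x k q ^ p.1

theorem x_pow_mul_y_pow (a b : ℕ) :
    x k q ^ a * y k q ^ b = q ^ (a * b) • monomial k q (a, b) := by
  have h1 : ∀ b : ℕ, x k q * y k q ^ b = q ^ b • (y k q ^ b * x k q) := by
    intro b
    induction b with
    | zero => simp
    | succ b ih =>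
      rw [pow_succ, ← mul_assoc, ih, smul_mul_assoc, mul_assoc, x_mul_y, mul_smul_comm, smul_smul,
        ← pow_succ, mul_assoc]
  unfold monomial
  induction a with
  | zero => simp
  | succ a ih =>
    rw [pow_succ', mul_assoc, ih, mul_smul_comm, ← mul_assoc, h1, smul_mul_assoc, smul_smul,
      mul_assoc, ← pow_add, Nat.succ_mul]

theorem monomial_mul (a b c d : ℕ) :
    monomial k q (a, b) * monomial k q (c, d) = q ^ (a * d) • monomial k q (a + c, b + d) := by
  have h : monomial k q (a, b) * monomial k q (c, d)
      = y k q ^ b * (x k q ^ a * y k q ^ d) * x k q ^ c := by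
    simp [monomial, mul_assoc]
  rw [h, x_pow_mul_y_pow]
  simp [monomial, pow_add, mul_assoc]

theorem monomial_zero : monomial k q (0, 0) = 1 := by simp [monomial]

theorem monomial_x : monomial k q (1, 0) = x k q := by simp [monomial]

theorem monomial_y : monomial k q (0, 1) = y k q := by simp [monomial]

/-- The left regular representation of the quantum plane, in the coordinates with respect to the
monomials `y ^ b x ^ a`. -/
noncomputable def regularRep (k : Type*) [Field k] (q : k) :
    QuantumPlane k q →ₐ[k] Module.End k (ℕ × ℕ →₀ k) :=
  lift (Finsupp.linearCombination k fun p : ℕ × ℕ => Finsupp.single (p.1 + 1, p.2) (q ^ p.2))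
    (Finsupp.linearCombination k fun p : ℕ × ℕ => Finsupp.single (p.1, p.2 + 1) 1)
    (by
      apply Finsupp.lhom_ext'
      intro p
      ext
      simp [pow_succ, mul_comm])

theorem regularRep_monomial (p : ℕ × ℕ) :
    regularRep k q (monomial k q p) (Finsupp.single (0, 0) 1) = Finsupp.single p 1 := by
  obtain ⟨a, b⟩ := p
  have hx : ∀ a : ℕ, (regularRep k q (x k q) ^ a) (Finsupp.single (0, 0) 1)
      = Finsupp.single (a, 0) 1 := by
    intro a
    induction a with
    | zero => simp
    | succ a ih => rw [pow_succ', Module.End.mul_apply, ih]; simp [regularRep]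
  have hy : ∀ b : ℕ, (regularRep k q (y k q) ^ b) (Finsupp.single (a, 0) 1)
      = Finsupp.single (a, b) 1 := by
    intro b
    induction b with
    | zero => simp
    | succ b ih => rw [pow_succ', Module.End.mul_apply, ih]; simp [regularRep]
  rw [monomial, map_mul, map_pow, map_pow, Module.End.mul_apply, hx, hy]

theorem linearIndependent_monomial : LinearIndependent k (monomial k q) := by
  refine LinearIndependent.of_comp ((LinearMap.applyₗ (Finsupp.single (0, 0) 1)) ∘ₗ
    (regularRep k q).toLinearMap) ?_
  convert (Finsupp.basisSingleOne (R := k) (ι := ℕ × ℕ)).linearIndependent using 1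
  funext p
  simp [regularRep_monomial]

theorem span_monomial : ⊤ ≤ Submodule.span k (Set.range (monomial k q)) := by
  have hmul : Submodule.span k (Set.range (monomial k q)) *
      Submodule.span k (Set.range (monomial k q)) ≤ Submodule.span k (Set.range (monomial k q)) := by
    rw [Submodule.span_mul_span, Submodule.span_le]
    rintro _ ⟨_, ⟨⟨a, b⟩, rfl⟩, _, ⟨⟨c, d⟩, rfl⟩, rfl⟩
    simp only [monomial_mul]
    exact Submodule.smul_mem _ _ (Submodule.subset_span ⟨_, rfl⟩)
  intro u _
  induction u using QuantumPlane.induction with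
  | hc c =>
    rw [Algebra.algebraMap_eq_smul_one, ← monomial_zero]
    exact Submodule.smul_mem _ _ (Submodule.subset_span ⟨_, rfl⟩)
  | hx => exact Submodule.subset_span ⟨_, monomial_x⟩
  | hy => exact Submodule.subset_span ⟨_, monomial_y⟩
  | hm a b ha hb => exact hmul (Submodule.mul_mem_mul (ha trivial) (hb trivial))
  | ha a b ha hb => exact Submodule.add_mem _ (ha trivial) (hb trivial)

/-- The basis of monomials `y ^ b x ^ a`, indexed by `(a, b)`. -/
noncomputable def basis (k : Type*) [Field k] (q : k) :
    Module.Basis (ℕ × ℕ) k (QuantumPlane k q) :=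
  Module.Basis.mk linearIndependent_monomial span_monomial

@[simp]
theorem basis_apply (p : ℕ × ℕ) : basis k q p = monomial k q p := by
  simp [basis]

theorem degreePart_eq_span (n : ℕ) :
    degreePart k q n = Submodule.span k (monomial k q '' {p | p.1 + p.2 = n}) := by
  have hle : ∀ {p : ℕ × ℕ} {n : ℕ}, p.1 + p.2 = n →
      monomial k q p ∈ Submodule.span k (monomial k q '' {p | p.1 + p.2 = n}) :=
    fun h => Submodule.subset_span ⟨_, h, rfl⟩
  apply le_antisymm
  · induction n with
    | zero =>
      rw [degreePart, pow_zero, Submodule.one_eq_span, Submodule.span_le, Set.singleton_subset_iff,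
        ← monomial_zero]
      exact hle rfl
    | succ n ih =>
      rw [degreePart, pow_succ]
      refine (mul_le_mul_left ih _).trans ?_
      rw [Submodule.span_mul_span, Submodule.span_le]
      rintro _ ⟨_, ⟨⟨a, b⟩, hab, rfl⟩, _, (rfl | rfl), rfl⟩
      · simp only [← monomial_x, monomial_mul]
        exact Submodule.smul_mem _ _ (hle (by simp at hab ⊢; omega))
      · simp only [← monomial_y, monomial_mul]
        exact Submodule.smul_mem _ _ (hle (by simp at hab ⊢; omega))
  · rw [Submodule.span_le]
    rintro _ ⟨⟨a, b⟩, rfl, rfl⟩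
    simp only [monomial, degreePart, SetLike.mem_coe]
    rw [add_comm, pow_add]
    exact Submodule.mul_mem_mul (Submodule.pow_mem_pow _ (Submodule.subset_span (by simp)) _)
      (Submodule.pow_mem_pow _ (Submodule.subset_span (by simp)) _)

theorem weightPart_eq_span (hq : q ≠ 0) (i : ℤ) :
    weightPart k q i
      = Submodule.span k (monomial k q '' {p | (p.2 : ℤ) - (p.1 : ℤ) = i}) := by
  apply le_antisymm <;> rw [weightPart, Submodule.span_le]
  · rintro _ ⟨a, b, h, rfl⟩
    rw [x_pow_mul_y_pow]
    exact Submodule.smul_mem _ _ (Submodule.subset_span ⟨(a, b), h, rfl⟩)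
  · rintro _ ⟨⟨a, b⟩, h, rfl⟩
    have h1 : monomial k q (a, b) = (q ^ (a * b))⁻¹ • (x k q ^ a * y k q ^ b) := by
      rw [x_pow_mul_y_pow, smul_smul, inv_mul_cancel₀ (pow_ne_zero _ hq), one_smul]
    rw [h1]
    exact Submodule.smul_mem _ _ (Submodule.subset_span ⟨a, b, h, rfl⟩)

theorem monomial_mem_weightPart (hq : q ≠ 0) (a b : ℕ) :
    monomial k q (a, b) ∈ weightPart k q ((b : ℤ) - a) := by
  rw [weightPart_eq_span hq]
  exact Submodule.subset_span ⟨(a, b), rfl, rfl⟩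

end

end QuantumPlane

/-- A partition of a basis decomposes the module into the spans of its parts. -/
theorem Module.Basis.isInternal_span_image {R M ι J : Type*} [Ring R] [Nontrivial R]
    [AddCommGroup M] [Module R M] [DecidableEq J] (b : Module.Basis ι R M) (f : ι → J) :
    DirectSum.IsInternal fun j => Submodule.span R (b '' {i | f i = j}) := by
  apply (DirectSum.isInternal_submodule_iff_iSupIndep_and_iSup_eq_top _).2
  constructor
  · intro j
    have hdisj : Disjoint {i | f i = j} {i | f i ≠ j} :=
      Set.disjoint_left.2 fun i hi hi' => hi' hi
    refine (b.linearIndependent.disjoint_span_image hdisj).mono_right ?_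
    refine iSup₂_le fun j' hj' => Submodule.span_mono (Set.image_mono ?_)
    rintro i rfl
    exact hj'
  · rw [eq_top_iff, ← b.span_eq, Submodule.span_le]
    rintro _ ⟨i, rfl⟩
    exact Submodule.mem_iSup_of_mem (f i) (Submodule.subset_span ⟨i, rfl, rfl⟩)

/-! ### The action of `U_q(sl₂)` on the quantum plane -/

theorem sub_inv_ne_zero_of_sq_ne_one {k : Type*} [Field k] {q : k} (hq : q ≠ 0)
    (hq2 : q ^ 2 ≠ 1) : q - q⁻¹ ≠ 0 := by
  intro h
  apply hq2
  rw [sub_eq_zero] at h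
  rw [sq]
  nth_rewrite 2 [h]
  exact mul_inv_cancel₀ hq

theorem qNumber_zero {k : Type*} [Field k] (q : k) : qNumber q 0 = 0 := by simp [qNumber]

theorem qNumber_one {k : Type*} [Field k] {q : k} (h : q - q⁻¹ ≠ 0) : qNumber q 1 = 1 := by
  simp [qNumber, h]

theorem qNumber_add {k : Type*} [Field k] {q : k} (hq : q ≠ 0) (m n : ℕ) :
    qNumber q (m + n) = (q ^ n)⁻¹ * qNumber q m + q ^ m * qNumber q n := by
  simp only [qNumber, ← mul_div_assoc, ← add_div]
  congr 1
  field_simp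
  ring

/-- The falling `q`-factorial `[a]_q [a - 1]_q ⋯ [a - r + 1]_q`. It vanishes for `r > a` because
of the factor `[0]_q`. -/
def qFalling {k : Type*} [Field k] (q : k) (a r : ℕ) : k :=
  ∏ t ∈ Finset.range r, qNumber q (a - t)

theorem qFalling_eq_zero {k : Type*} [Field k] (q : k) {a r : ℕ} (h : a < r) :
    qFalling q a r = 0 :=
  Finset.prod_eq_zero (Finset.mem_range.2 h) (by rw [Nat.sub_self, qNumber_zero])

/-- The scalar identity behind the relation `E F - F E = (K - K⁻¹) / (q - q⁻¹)`. -/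
theorem qNumber_mul_sub_qNumber_mul {k : Type*} [Field k] {q : k} (hq : q ≠ 0)
    (h : q - q⁻¹ ≠ 0) (a b : ℕ) :
    qNumber q b * qNumber q (a + 1) - qNumber q a * qNumber q (b + 1)
      = (q - q⁻¹)⁻¹ * (q ^ ((b : ℤ) - a) - q ^ ((a : ℤ) - b)) := by
  have hk : (q - q⁻¹) ^ 2 ≠ 0 := pow_ne_zero 2 h
  simp only [qNumber, zpow_sub₀ hq, zpow_natCast]
  rw [div_mul_div_comm, div_mul_div_comm, ← sub_div, ← sq, div_eq_iff hk, sq]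
  rw [show ∀ u v w : k, u⁻¹ * v * (u * w) = (u⁻¹ * u) * (v * w) by intros; ring,
    inv_mul_cancel₀ h]
  field_simp
  ring

@[simp]
theorem tensorAction_tmul {k H M N : Type*} [Field k] [Ring H] [Algebra k H]
    [AddCommGroup M] [Module k M] [AddCommGroup N] [Module k N]
    (ρ : H →ₐ[k] Module.End k M) (ρ' : H →ₐ[k] Module.End k N) (u v : H) (m : M) (n : N) :
    tensorAction ρ ρ' (u ⊗ₜ[k] v) (m ⊗ₜ[k] n) = ρ u m ⊗ₜ[k] ρ' v n := by
  simp only [tensorAction, AlgHom.comp_apply, Algebra.TensorProduct.map_tmul]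
  rfl

namespace IsModuleAlgebra

variable {k : Type*} [Field k] {q : k} {A : Type*} [Ring A] [Algebra k A]
  {ρ : Uq k q →ₐ[k] Module.End k A}

/-- The product rule of a module algebra has to be checked on the generators of `U_q(sl₂)` only. -/
theorem of_gen
    (hE : ∀ a b, ρ (Uq.E k q) (a * b) = a * ρ (Uq.E k q) b + ρ (Uq.E k q) a * ρ (Uq.K k q) b)
    (hF : ∀ a b, ρ (Uq.F k q) (a * b)
      = ρ (Uq.Kinv k q) a * ρ (Uq.F k q) b + ρ (Uq.F k q) a * b)
    (hK : ∀ a b, ρ (Uq.K k q) (a * b) = ρ (Uq.K k q) a * ρ (Uq.K k q) b)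
    (hKinv : ∀ a b, ρ (Uq.Kinv k q) (a * b) = ρ (Uq.Kinv k q) a * ρ (Uq.Kinv k q) b)
    (h1 : ∀ g, ρ (Uq.gen k q g) 1 = algebraMap k A (Uq.counitGen k g)) :
    IsModuleAlgebra ρ := by
  have key : ∀ u : Uq k q, (ρ u) ∘ₗ LinearMap.mul' k A
      = LinearMap.mul' k A ∘ₗ tensorAction ρ ρ (Coalgebra.comul (R := k) u) := by
    intro u
    induction u using Uq.induction with
    | hc c =>
      ext a b
      simp [Algebra.algebraMap_eq_smul_one]
    | hg g =>
      rw [Uq.comul_gen]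
      ext a b
      cases g <;> simp [Uq.comulGen, hE, hF, hK, hKinv]
    | hm a b ha hb =>
      rw [Bialgebra.comul_mul, map_mul, map_mul, Module.End.mul_eq_comp, Module.End.mul_eq_comp,
        LinearMap.comp_assoc, hb, ← LinearMap.comp_assoc, ha, LinearMap.comp_assoc]
    | ha a b ha hb => simp only [map_add, LinearMap.add_comp, LinearMap.comp_add, ha, hb]
  refine ⟨fun u a b => ?_, fun u => ?_⟩
  · simpa using LinearMap.congr_fun (key u) (a ⊗ₜ[k] b)
  · induction u using Uq.induction with
    | hc c => simp [Algebra.algebraMap_eq_smul_one]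
    | hg g => rw [h1, Uq.counit_gen]
    | hm a b ha hb =>
      rw [map_mul, Module.End.mul_apply, hb, Algebra.algebraMap_eq_smul_one, map_smul, ha,
        Bialgebra.counit_mul, Algebra.smul_def, ← map_mul, mul_comm]
    | ha a b ha hb => simp only [map_add, LinearMap.add_apply, ha, hb]

theorem act_E_mul (h : IsModuleAlgebra ρ) (a b : A) :
    ρ (Uq.E k q) (a * b) = a * ρ (Uq.E k q) b + ρ (Uq.E k q) a * ρ (Uq.K k q) b := by
  rw [h.act_mul, Uq.comul_gen]
  simp [Uq.comulGen]

theorem act_F_mul (h : IsModuleAlgebra ρ) (a b : A) :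
    ρ (Uq.F k q) (a * b) = ρ (Uq.Kinv k q) a * ρ (Uq.F k q) b + ρ (Uq.F k q) a * b := by
  rw [h.act_mul, Uq.comul_gen]
  simp [Uq.comulGen]

theorem act_K_mul (h : IsModuleAlgebra ρ) (a b : A) :
    ρ (Uq.K k q) (a * b) = ρ (Uq.K k q) a * ρ (Uq.K k q) b := by
  rw [h.act_mul, Uq.comul_gen]
  simp [Uq.comulGen]

theorem act_Kinv_mul (h : IsModuleAlgebra ρ) (a b : A) :
    ρ (Uq.Kinv k q) (a * b) = ρ (Uq.Kinv k q) a * ρ (Uq.Kinv k q) b := by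
  rw [h.act_mul, Uq.comul_gen]
  simp [Uq.comulGen]

end IsModuleAlgebra

/-- A module algebra structure on the quantum plane is determined by its values on `x` and `y`. -/
theorem IsPlaneAction.unique {k : Type*} [Field k] {q : k}
    {ρ ρ' : Uq k q →ₐ[k] Module.End k (QuantumPlane k q)} (h : IsPlaneAction ρ)
    (h' : IsPlaneAction ρ') : ρ' = ρ := by
  have key : ∀ (a : QuantumPlane k q) (g : UqGen), ρ' (Uq.gen k q g) a = ρ (Uq.gen k q g) a := by
    intro a
    induction a using QuantumPlane.induction with
    | hc c =>
      intro g
      rw [Algebra.algebraMap_eq_smul_one, map_smul, map_smul, h.isModuleAlgebra.act_one,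
        h'.isModuleAlgebra.act_one]
    | hx => rintro (_ | _ | _ | _) <;> simp only [h.E_x, h.F_x, h.K_x, h.Kinv_x, h'.E_x, h'.F_x,
        h'.K_x, h'.Kinv_x]
    | hy => rintro (_ | _ | _ | _) <;> simp only [h.E_y, h.F_y, h.K_y, h.Kinv_y, h'.E_y, h'.F_y,
        h'.K_y, h'.Kinv_y]
    | hm a b ha hb =>
      rintro (_ | _ | _ | _) <;>
        simp only [h.isModuleAlgebra.act_E_mul, h'.isModuleAlgebra.act_E_mul,
          h.isModuleAlgebra.act_F_mul, h'.isModuleAlgebra.act_F_mul,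
          h.isModuleAlgebra.act_K_mul, h'.isModuleAlgebra.act_K_mul,
          h.isModuleAlgebra.act_Kinv_mul, h'.isModuleAlgebra.act_Kinv_mul, ha, hb]
    | ha a b ha hb => intro g; rw [map_add, map_add, ha, hb]
  exact Uq.algHom_ext fun g => LinearMap.ext fun a => key a g

namespace QuantumPlane

section

variable {k : Type*} [Field k] {q : k}

/-- The operators on the quantum plane by which the generators of `U_q(sl₂)` act, given on the
monomials `y ^ b x ^ a`. For `a = 0` in `E` and `b = 0` in `F`, the truncated exponent does not
matter because its coefficient `[0]_q` vanishes. -/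
noncomputable def genAction (k : Type*) [Field k] (q : k) :
    UqGen → Module.End k (QuantumPlane k q)
  | .E => (basis k q).constr k fun p => qNumber q p.1 • monomial k q (p.1 - 1, p.2 + 1)
  | .F => (basis k q).constr k fun p => qNumber q p.2 • monomial k q (p.1 + 1, p.2 - 1)
  | .K => (basis k q).constr k fun p => q ^ ((p.2 : ℤ) - p.1) • monomial k q p
  | .Kinv => (basis k q).constr k fun p => q ^ ((p.1 : ℤ) - p.2) • monomial k q p

theorem genAction_E (a b : ℕ) : genAction k q .E (monomial k q (a, b))
    = qNumber q a • monomial k q (a - 1, b + 1) := by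
  rw [← basis_apply, genAction, Module.Basis.constr_basis]

theorem genAction_F (a b : ℕ) : genAction k q .F (monomial k q (a, b))
    = qNumber q b • monomial k q (a + 1, b - 1) := by
  rw [← basis_apply, genAction, Module.Basis.constr_basis]

theorem genAction_K (a b : ℕ) : genAction k q .K (monomial k q (a, b))
    = q ^ ((b : ℤ) - a) • monomial k q (a, b) := by
  rw [← basis_apply, genAction, Module.Basis.constr_basis, basis_apply]

theorem genAction_Kinv (a b : ℕ) : genAction k q .Kinv (monomial k q (a, b))
    = q ^ ((a : ℤ) - b) • monomial k q (a, b) := by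
  rw [← basis_apply, genAction, Module.Basis.constr_basis, basis_apply]

theorem hom_ext_monomial {M : Type*} [AddCommGroup M] [Module k M] {f g : QuantumPlane k q →ₗ[k] M}
    (h : ∀ a b, f (monomial k q (a, b)) = g (monomial k q (a, b))) : f = g :=
  (basis k q).ext fun p => by simpa using h p.1 p.2

theorem bilin_ext_monomial {M : Type*} [AddCommGroup M] [Module k M]
    {f g : QuantumPlane k q →ₗ[k] QuantumPlane k q →ₗ[k] M}
    (h : ∀ a b c d, f (monomial k q (a, b)) (monomial k q (c, d))
      = g (monomial k q (a, b)) (monomial k q (c, d))) : f = g :=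
  hom_ext_monomial fun a b => hom_ext_monomial fun c d => h a b c d

/-- The action of `U_q(sl₂)` on the quantum plane. -/
noncomputable def action (hq : q ≠ 0) (hq2 : q ^ 2 ≠ 1) :
    Uq k q →ₐ[k] Module.End k (QuantumPlane k q) :=
  Uq.lift (genAction k q)
    (hom_ext_monomial fun a b => by
      simp only [Module.End.mul_apply, genAction_K, genAction_Kinv, map_smul, smul_smul]
      rw [← zpow_add₀ hq]; simp)
    (hom_ext_monomial fun a b => by
      simp only [Module.End.mul_apply, genAction_K, genAction_Kinv, map_smul, smul_smul]
      rw [← zpow_add₀ hq]; simp)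
    (hom_ext_monomial fun a b => by
      simp only [Module.End.mul_apply, LinearMap.smul_apply, genAction_K, genAction_E, map_smul,
        smul_smul]
      rcases a with _ | a
      · simp [qNumber_zero]
      · congr 1
        rw [mul_comm, ← mul_assoc, ← zpow_natCast, ← zpow_add₀ hq]
        congr 2
        rw [Nat.add_sub_cancel]
        push_cast
        ring)
    (hom_ext_monomial fun a b => by
      simp only [Module.End.mul_apply, LinearMap.smul_apply, genAction_K, genAction_F, map_smul,
        smul_smul]
      rcases b with _ | b
      · simp [qNumber_zero]
      · congr 1
        rw [mul_comm, ← mul_assoc, ← zpow_natCast, ← zpow_neg,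
          ← zpow_add₀ hq]
        congr 2
        rw [Nat.add_sub_cancel]
        push_cast
        ring)
    (hom_ext_monomial fun a b => by
      have h := qNumber_mul_sub_qNumber_mul hq (sub_inv_ne_zero_of_sq_ne_one hq hq2) a b
      simp only [Module.End.mul_apply, LinearMap.smul_apply, LinearMap.sub_apply, genAction_K,
        genAction_Kinv, genAction_E, genAction_F, map_smul, smul_smul]
      rw [← sub_smul, smul_smul, ← h]
      rcases a with _ | a <;> rcases b with _ | b <;> simp [qNumber_zero, sub_smul])

theorem genAction_E_monomial_mul (hq : q ≠ 0) (a b c d : ℕ) :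
    genAction k q .E (monomial k q (a, b) * monomial k q (c, d))
      = monomial k q (a, b) * genAction k q .E (monomial k q (c, d))
        + genAction k q .E (monomial k q (a, b)) * genAction k q .K (monomial k q (c, d)) := by
  have h1 : monomial k q (a, b) * genAction k q .E (monomial k q (c, d))
      = (q ^ (a * (d + 1)) * qNumber q c) • monomial k q (a + c - 1, b + d + 1) := by
    rw [genAction_E, mul_smul_comm, monomial_mul, smul_smul, mul_comm]
    rcases c with _ | c
    · simp [qNumber_zero]
    · rfl
  have h2 : genAction k q .E (monomial k q (a, b)) * genAction k q .K (monomial k q (c, d))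
      = (q ^ (a * d) * (q ^ c)⁻¹ * qNumber q a) • monomial k q (a + c - 1, b + d + 1) := by
    rw [genAction_E, genAction_K, smul_mul_smul_comm, monomial_mul, smul_smul]
    rcases a with _ | a
    · simp [qNumber_zero]
    · rw [show a + 1 - 1 + c = a + 1 + c - 1 by omega, add_right_comm b 1 d,
        zpow_sub₀ hq, zpow_natCast, zpow_natCast, Nat.add_sub_cancel]
      congr 1
      ring
  rw [h1, h2, monomial_mul, map_smul, genAction_E, smul_smul, ← add_smul, qNumber_add hq]
  congr 1
  ring

theorem genAction_F_monomial_mul (hq : q ≠ 0) (a b c d : ℕ) :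
    genAction k q .F (monomial k q (a, b) * monomial k q (c, d))
      = genAction k q .Kinv (monomial k q (a, b)) * genAction k q .F (monomial k q (c, d))
        + genAction k q .F (monomial k q (a, b)) * monomial k q (c, d) := by
  have h1 : genAction k q .Kinv (monomial k q (a, b)) * genAction k q .F (monomial k q (c, d))
      = (q ^ (a * d) * (q ^ b)⁻¹ * qNumber q d) • monomial k q (a + c + 1, b + d - 1) := by
    rw [genAction_F, genAction_Kinv, smul_mul_smul_comm, monomial_mul, smul_smul]
    rcases d with _ | d
    · simp [qNumber_zero]
    · rw [← add_assoc a c 1, show b + (d + 1 - 1) = b + (d + 1) - 1 by omega, zpow_sub₀ hq,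
        zpow_natCast, zpow_natCast, Nat.add_sub_cancel]
      congr 1
      ring
  have h2 : genAction k q .F (monomial k q (a, b)) * monomial k q (c, d)
      = (q ^ ((a + 1) * d) * qNumber q b) • monomial k q (a + c + 1, b + d - 1) := by
    rw [genAction_F, smul_mul_assoc, monomial_mul, smul_smul, mul_comm]
    rcases b with _ | b
    · simp [qNumber_zero]
    · rw [show b + 1 - 1 + d = b + 1 + d - 1 by omega, add_right_comm a 1 c]
  rw [h1, h2, monomial_mul, map_smul, genAction_F, smul_smul, ← add_smul, add_comm b d,
    qNumber_add hq]
  congr 1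
  ring

theorem genAction_K_monomial_mul (hq : q ≠ 0) (a b c d : ℕ) :
    genAction k q .K (monomial k q (a, b) * monomial k q (c, d))
      = genAction k q .K (monomial k q (a, b)) * genAction k q .K (monomial k q (c, d)) := by
  rw [genAction_K, genAction_K, smul_mul_smul_comm, monomial_mul, map_smul, genAction_K,
    smul_comm, ← zpow_add₀ hq]
  congr 2
  push_cast
  ring

theorem genAction_Kinv_monomial_mul (hq : q ≠ 0) (a b c d : ℕ) :
    genAction k q .Kinv (monomial k q (a, b) * monomial k q (c, d))
      = genAction k q .Kinv (monomial k q (a, b)) * genAction k q .Kinv (monomial k q (c, d)) := by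
  rw [genAction_Kinv, genAction_Kinv, smul_mul_smul_comm, monomial_mul, map_smul, genAction_Kinv,
    smul_comm, ← zpow_add₀ hq]
  congr 2
  push_cast
  ring

variable (hq : q ≠ 0) (hq2 : q ^ 2 ≠ 1)

theorem action_gen (g : UqGen) : action hq hq2 (Uq.gen k q g) = genAction k q g :=
  Uq.lift_gen _ _ _ _ _ _ _

theorem isModuleAlgebra_action : IsModuleAlgebra (action hq hq2) := by
  have hbil : ∀ f g : QuantumPlane k q →ₗ[k] QuantumPlane k q →ₗ[k] QuantumPlane k q,
      (∀ a b c d, f (monomial k q (a, b)) (monomial k q (c, d))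
        = g (monomial k q (a, b)) (monomial k q (c, d))) → ∀ u v, f u v = g u v :=
    fun f g h u v => by rw [bilin_ext_monomial h]
  refine IsModuleAlgebra.of_gen
    (hbil ((LinearMap.mul k _).compr₂ _)
      ((LinearMap.mul k _).compl₂ (action hq hq2 (Uq.E k q)) +
        (LinearMap.mul k _).compl₁₂ (action hq hq2 (Uq.E k q)) (action hq hq2 (Uq.K k q))) ?_)
    (hbil ((LinearMap.mul k _).compr₂ _)
      ((LinearMap.mul k _).compl₁₂ (action hq hq2 (Uq.Kinv k q)) (action hq hq2 (Uq.F k q)) +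
        (LinearMap.mul k _).comp (action hq hq2 (Uq.F k q))) ?_)
    (hbil ((LinearMap.mul k _).compr₂ _)
      ((LinearMap.mul k _).compl₁₂ (action hq hq2 (Uq.K k q)) (action hq hq2 (Uq.K k q))) ?_)
    (hbil ((LinearMap.mul k _).compr₂ _)
      ((LinearMap.mul k _).compl₁₂ (action hq hq2 (Uq.Kinv k q)) (action hq hq2 (Uq.Kinv k q))) ?_)
    ?_
  · intro a b c d
    simp only [action_gen]
    exact genAction_E_monomial_mul hq a b c d
  · intro a b c d
    simp only [action_gen]
    exact genAction_F_monomial_mul hq a b c d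
  · intro a b c d
    simp only [action_gen]
    exact genAction_K_monomial_mul hq a b c d
  · intro a b c d
    simp only [action_gen]
    exact genAction_Kinv_monomial_mul hq a b c d
  · intro g
    rw [action_gen, ← map_one (algebraMap k _), Algebra.algebraMap_eq_smul_one, ← monomial_zero]
    cases g <;> simp only [genAction_E, genAction_F, genAction_K, genAction_Kinv, qNumber_zero,
      Uq.counitGen, map_smul, Algebra.algebraMap_eq_smul_one, ← monomial_zero, smul_smul] <;> simp

theorem isPlaneAction_action : IsPlaneAction (action hq hq2) := by
  have h1 := qNumber_one (sub_inv_ne_zero_of_sq_ne_one hq hq2)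
  refine ⟨isModuleAlgebra_action hq hq2, ?_, ?_, ?_, ?_, ?_, ?_, ?_, ?_⟩ <;>
    simp [action_gen, ← monomial_x, ← monomial_y, genAction_E, genAction_F, genAction_K,
      genAction_Kinv, qNumber_zero, h1]

theorem action_mem_degreePart (u : Uq k q) (n : ℕ) {v : QuantumPlane k q}
    (hv : v ∈ degreePart k q n) : action hq hq2 u v ∈ degreePart k q n := by
  have key : degreePart k q n ≤ (degreePart k q n).comap (action hq hq2 u) := by
    induction u using Uq.induction with
    | hc c =>
      intro v hv
      simpa [Algebra.algebraMap_eq_smul_one] using Submodule.smul_mem _ _ hv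
    | hg g =>
      have hmem : ∀ a b : ℕ, a + b = n → monomial k q (a, b) ∈ degreePart k q n := by
        intro a b h
        rw [degreePart_eq_span]
        exact Submodule.subset_span ⟨(a, b), h, rfl⟩
      rw [action_gen]
      conv_lhs => rw [degreePart_eq_span]
      rw [Submodule.span_le]
      rintro _ ⟨⟨a, b⟩, hab, rfl⟩
      simp only [Set.mem_ofPred_eq] at hab
      simp only [Submodule.comap_coe, Set.mem_preimage, SetLike.mem_coe]
      cases g with
      | E =>
        rw [genAction_E]
        rcases a with _ | a
        · simp [qNumber_zero]
        · exact Submodule.smul_mem _ _ (hmem _ _ (by omega))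
      | F =>
        rw [genAction_F]
        rcases b with _ | b
        · simp [qNumber_zero]
        · exact Submodule.smul_mem _ _ (hmem _ _ (by omega))
      | K => rw [genAction_K]; exact Submodule.smul_mem _ _ (hmem _ _ hab)
      | Kinv => rw [genAction_Kinv]; exact Submodule.smul_mem _ _ (hmem _ _ hab)
    | hm a b ha hb =>
      intro v hv
      simpa using ha (hb hv)
    | ha a b ha hb =>
      intro v hv
      rw [Submodule.mem_comap, map_add]
      exact Submodule.add_mem _ (ha hv) (hb hv)
  exact key hv

theorem isWeightDecomposition_action :
    IsWeightDecomposition (action hq hq2) (weightPart k q) := by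
  have hspan : ∀ (i j : ℤ) (f : Module.End k (QuantumPlane k q)),
      (∀ a b : ℕ, (b : ℤ) - a = i → f (monomial k q (a, b)) ∈ weightPart k q j) →
      ∀ m ∈ weightPart k q i, f m ∈ weightPart k q j := by
    intro i j f hf
    suffices h : weightPart k q i ≤ (weightPart k q j).comap f from fun m hm => h hm
    rw [weightPart_eq_span hq i, Submodule.span_le]
    rintro _ ⟨⟨a, b⟩, hab, rfl⟩
    exact hf a b hab
  refine ⟨?_, ?_, ?_, ?_⟩
  · have h := (basis k q).isInternal_span_image fun p => (p.2 : ℤ) - (p.1 : ℤ)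
    convert h using 2 with i
    rw [weightPart_eq_span hq]
    simp
  · intro i
    suffices h : weightPart k q i ≤
        LinearMap.ker (action hq hq2 (Uq.K k q) - q ^ i • LinearMap.id) from fun m hm => by
      simpa [sub_eq_zero] using h hm
    rw [weightPart_eq_span hq, Submodule.span_le]
    rintro _ ⟨⟨a, b⟩, rfl, rfl⟩
    simp [action_gen, genAction_K]
  · refine fun i => hspan _ _ _ fun a b hab => ?_
    rw [action_gen, genAction_E]
    rcases a with _ | a
    · simp [qNumber_zero]
    · convert Submodule.smul_mem _ _ (monomial_mem_weightPart hq _ _) using 2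
      push_cast [Nat.add_sub_cancel] at hab ⊢
      omega
  · refine fun i => hspan _ _ _ fun a b hab => ?_
    rw [action_gen, genAction_F]
    rcases b with _ | b
    · simp [qNumber_zero]
    · convert Submodule.smul_mem _ _ (monomial_mem_weightPart hq _ _) using 2
      push_cast [Nat.add_sub_cancel] at hab ⊢
      omega

theorem action_E_pow_monomial (r a b : ℕ) :
    action hq hq2 (Uq.E k q ^ r) (monomial k q (a, b))
      = qFalling q a r • monomial k q (a - r, b + r) := by
  induction r with
  | zero => simp [qFalling]
  | succ r ih =>
    rw [pow_succ', map_mul, Module.End.mul_apply, ih, map_smul, action_gen, genAction_E, smul_smul,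
      qFalling, qFalling, Finset.prod_range_succ, Nat.sub_sub, add_assoc]

theorem action_F_pow_monomial (r a b : ℕ) :
    action hq hq2 (Uq.F k q ^ r) (monomial k q (a, b))
      = qFalling q b r • monomial k q (a + r, b - r) := by
  induction r with
  | zero => simp [qFalling]
  | succ r ih =>
    rw [pow_succ', map_mul, Module.End.mul_apply, ih, map_smul, action_gen, genAction_F, smul_smul,
      qFalling, qFalling, Finset.prod_range_succ, Nat.sub_sub, add_assoc]

theorem isLocallyNilpotent_action : IsLocallyNilpotent (action hq hq2) := by
  intro m
  have hmono : ∀ {m : QuantumPlane k q} {n n' : ℕ}, n ≤ n' →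
      action hq hq2 (Uq.E k q ^ n) m = 0 → action hq hq2 (Uq.E k q ^ n') m = 0 := by
    intro m n n' h h0
    rw [← Nat.sub_add_cancel h, pow_add, map_mul, Module.End.mul_apply, h0, map_zero]
  have hm : m ∈ Submodule.span k (Set.range (monomial k q)) := span_monomial trivial
  induction hm using Submodule.span_induction with
  | zero => exact ⟨0, map_zero _⟩
  | add u v _ _ hu hv =>
    obtain ⟨n, hn⟩ := hu
    obtain ⟨n', hn'⟩ := hv
    refine ⟨max n n', ?_⟩
    rw [map_add, hmono (le_max_left _ _) hn, hmono (le_max_right _ _) hn', add_zero]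
  | smul c u _ hu =>
    obtain ⟨n, hn⟩ := hu
    exact ⟨n, by rw [map_smul, hn, smul_zero]⟩
  | mem u hu =>
    obtain ⟨⟨a, b⟩, rfl⟩ := hu
    exact ⟨a + 1, by
      rw [action_E_pow_monomial, qFalling_eq_zero q (Nat.lt_succ_self _), zero_smul]⟩

end

end QuantumPlane

/-! ### Triangular operators -/

/-- If `N` is locally nilpotent, then `1 - N` is inverted by the geometric series. -/
theorem Module.End.bijective_one_sub {R M : Type*} [Ring R] [AddCommGroup M] [Module R M]
    (N : Module.End R M) (h : ∀ v, ∃ n : ℕ, (N ^ n) v = 0) :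
    Function.Bijective (1 - N : Module.End R M) := by
  constructor
  · rw [injective_iff_map_eq_zero]
    intro v hv
    have hv' : N v = v := by
      rw [LinearMap.sub_apply, Module.End.one_apply, sub_eq_zero] at hv
      exact hv.symm
    obtain ⟨n, hn⟩ := h v
    have hpow : ∀ n : ℕ, (N ^ n) v = v := by
      intro n
      induction n with
      | zero => rfl
      | succ n ih => rw [pow_succ, Module.End.mul_apply, hv', ih]
    rw [← hpow n, hn]
  · intro v
    obtain ⟨n, hn⟩ := h v
    refine ⟨(∑ i ∈ Finset.range n, N ^ i) v, ?_⟩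
    rw [← Module.End.mul_apply, mul_neg_geom_sum, LinearMap.sub_apply, hn, sub_zero,
      Module.End.one_apply]

/-- An operator that is triangular with nonzero diagonal entries `c i`, with respect to a basis
ranked by natural numbers, is bijective. The basis may be infinite, and so may be the set of its
elements of a given rank. -/
theorem Module.Basis.bijective_of_triangular {k M ι : Type*} [Field k] [AddCommGroup M]
    [Module k M] (β : Module.Basis ι k M) (h : ι → ℕ) (T : Module.End k M) (c : ι → k)
    (hc : ∀ i, c i ≠ 0)
    (hT : ∀ i, T (β i) - c i • β i ∈ Submodule.span k (β '' {j | h j < h i})) :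
    Function.Bijective T := by
  let D : M ≃ₗ[k] M :=
    β.equiv (β.unitsSMul fun i => Units.mk0 (c i) (hc i)) (Equiv.refl ι)
  have hD : ∀ i, D (β i) = c i • β i := fun i => by
    simp [D, Module.Basis.unitsSMul_apply, Units.smul_def]
  have hD' : ∀ i, D.symm (β i) = (c i)⁻¹ • β i := fun i => by
    rw [LinearEquiv.symm_apply_eq, map_smul, hD, smul_smul, inv_mul_cancel₀ (hc i), one_smul]
  -- After division by its diagonal part `D`, the operator is `1 - N`, where `N` lowers the rank.
  let N : Module.End k M := 1 - T * D.symm.toLinearMap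
  have hN : ∀ n, Submodule.span k (β '' {j | h j < n + 1})
      ≤ (Submodule.span k (β '' {j | h j < n})).comap N := by
    intro n
    rw [Submodule.span_le]
    rintro _ ⟨i, hi, rfl⟩
    have h1 : N (β i) = -((c i)⁻¹ • (T (β i) - c i • β i)) := by
      simp only [N, LinearMap.sub_apply, Module.End.one_apply, Module.End.mul_apply,
        LinearEquiv.coe_coe, hD', map_smul, smul_sub, smul_smul, inv_mul_cancel₀ (hc i), one_smul]
      abel
    simp only [Submodule.comap_coe, Set.mem_preimage, SetLike.mem_coe, h1]
    refine Submodule.neg_mem _ (Submodule.smul_mem _ _ (Submodule.span_mono ?_ (hT i)))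
    exact Set.image_mono fun j (hj : h j < h i) => lt_of_lt_of_le hj (Nat.lt_succ_iff.1 hi)
  have hnil : ∀ n, ∀ v ∈ Submodule.span k (β '' {j | h j < n}), (N ^ n) v = 0 := by
    intro n
    induction n with
    | zero => intro v hv; simpa using hv
    | succ n ih => intro v hv; rw [pow_succ, Module.End.mul_apply]; exact ih _ (hN n hv)
  have hex : ∀ v, ∃ n, v ∈ Submodule.span k (β '' {j | h j < n}) := by
    intro v
    have hv : v ∈ Submodule.span k (Set.range β) := by rw [β.span_eq]; trivial
    have hmono : ∀ {n n' : ℕ}, n ≤ n' → Submodule.span k (β '' {j | h j < n})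
        ≤ Submodule.span k (β '' {j | h j < n'}) := fun hn =>
      Submodule.span_mono (Set.image_mono fun j (hj : h j < _) => lt_of_lt_of_le hj hn)
    induction hv using Submodule.span_induction with
    | zero => exact ⟨0, Submodule.zero_mem _⟩
    | add u v _ _ hu hv =>
      obtain ⟨n, hn⟩ := hu
      obtain ⟨n', hn'⟩ := hv
      exact ⟨max n n', Submodule.add_mem _ (hmono (le_max_left _ _) hn)
        (hmono (le_max_right _ _) hn')⟩
    | smul c u _ hu =>
      obtain ⟨n, hn⟩ := hu
      exact ⟨n, Submodule.smul_mem _ _ hn⟩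
    | mem u hu =>
      obtain ⟨i, rfl⟩ := hu
      exact ⟨h i + 1, Submodule.subset_span ⟨i, Nat.lt_succ_self _, rfl⟩⟩
  have hbij := Module.End.bijective_one_sub N fun v => (hex v).imp fun n hn => hnil n v hn
  have hTD : (T : M → M) = (1 - N : Module.End k M) ∘ D := by
    funext v
    simp [N]
  rw [hTD]
  exact hbij.comp D.bijective

/-! ### A `q`-binomial identity -/

section qBinomial

variable {k : Type*} [Field k] {q : k}

/-- The symmetric `q`-binomial coefficient, given by a `q`-Pascal recursion, so that it makes sense
also if `q` is a root of unity. -/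
def qBinomial (q : k) : ℕ → ℕ → k
  | _, 0 => 1
  | 0, _ + 1 => 0
  | a + 1, r + 1 => (q ^ (r + 1))⁻¹ * qBinomial q a (r + 1) + q ^ a * (q ^ r)⁻¹ * qBinomial q a r

theorem qBinomial_zero_right (a : ℕ) : qBinomial q a 0 = 1 := by
  cases a <;> rfl

theorem qBinomial_eq_zero {a r : ℕ} (h : a < r) : qBinomial q a r = 0 := by
  induction a generalizing r with
  | zero =>
    obtain ⟨r, rfl⟩ := Nat.exists_eq_succ_of_ne_zero h.ne'
    rfl
  | succ a ih =>
    obtain ⟨r, rfl⟩ := Nat.exists_eq_succ_of_ne_zero (Nat.ne_zero_of_lt h)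
    rw [qBinomial, ih (by omega), ih (by omega), mul_zero, mul_zero, add_zero]

theorem qFalling_succ_right (a r : ℕ) :
    qFalling q a (r + 1) = qFalling q a r * qNumber q (a - r) :=
  Finset.prod_range_succ _ _

theorem qFalling_succ_right' (a r : ℕ) :
    qFalling q a (r + 1) = qNumber q a * qFalling q (a - 1) r := by
  rw [qFalling, Finset.prod_range_succ', mul_comm, qFalling]
  congr 1
  exact Finset.prod_congr rfl fun t _ => by rw [Nat.sub_sub, add_comm]

theorem qBinomial_mul_qFactorial (hq : q ≠ 0) (a r : ℕ) :
    qBinomial q a r * qFactorial q r = qFalling q a r := by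
  induction a generalizing r with
  | zero =>
    rcases r with _ | r
    · simp [qBinomial, qFactorial, qFalling]
    · rw [qBinomial_eq_zero (Nat.succ_pos r), qFalling_eq_zero q (Nat.succ_pos r), zero_mul]
  | succ a ih =>
    rcases r with _ | r
    · simp [qBinomial, qFactorial, qFalling]
    · have h1 : qFactorial q (r + 1) = qFactorial q r * qNumber q (r + 1) :=
        Finset.prod_range_succ _ _
      have h2 : qBinomial q (a + 1) (r + 1) * qFactorial q (r + 1)
          = (q ^ (r + 1))⁻¹ * (qBinomial q a (r + 1) * qFactorial q (r + 1))
            + q ^ a * (q ^ r)⁻¹ * qNumber q (r + 1) * (qBinomial q a r * qFactorial q r) := by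
        rw [qBinomial, h1]
        ring
      rw [h2, ih, ih, qFalling_succ_right, qFalling_succ_right', Nat.add_sub_cancel]
      rcases le_or_gt r a with h | h
      · have h3 : qNumber q (a + 1) = qNumber q (a - r + (r + 1)) := by congr 1; omega
        rw [h3, qNumber_add hq (a - r), pow_sub₀ q hq h]
        ring
      · rw [qFalling_eq_zero q h]
        ring

/-- If `[r]_q! = 0`, then the left side vanishes because the term is left out of the R-matrix, and
the right side because `[r]_q!` divides the falling factorial. -/
theorem rMatrixCoeff_mul_qFalling (hq : q ≠ 0) (a d r : ℕ) :
    rMatrixCoeff q r * (qFalling q a r * qFalling q d r)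
      = q ^ (r * (r - 1) / 2) * (q - q⁻¹) ^ r * qBinomial q a r * qFalling q d r := by
  by_cases h : qFactorial q r = 0
  · rw [← qBinomial_mul_qFactorial hq d r, h]
    simp
  · rw [← qBinomial_mul_qFactorial hq a r, rMatrixCoeff]
    field_simp

/-- The `q`-binomial theorem that expands the `a`-th power of `q ^ d` in the products
`∏ t < r, (q ^ (d - t) - q ^ (t - d)) = (q - q⁻¹) ^ r [d]_q ⋯ [d - r + 1]_q`. It is proved by
induction on `a`: the two terms of the `q`-Pascal rule give the sums for `(a, d)` and
`(a, d - 1)`. -/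
theorem sum_qBinomial_mul_qFalling (hq : q ≠ 0) (h : q - q⁻¹ ≠ 0) (a d : ℕ) :
    ∑ r ∈ Finset.range (a + 1), q ^ (r * (r - 1) / 2) * (q - q⁻¹) ^ r * qBinomial q a r
      * qFalling q d r * q ^ (-(((a : ℤ) - r) * ((d : ℤ) - r))) = q ^ (a * d) := by
  induction a generalizing d with
  | zero => simp [qBinomial, qFalling]
  | succ a ih =>
    set f : ℕ → ℕ → ℕ → k := fun a d r => q ^ (r * (r - 1) / 2) * (q - q⁻¹) ^ r * qBinomial q a r
      * qFalling q d r * q ^ (-(((a : ℤ) - r) * ((d : ℤ) - r))) with hf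
    have hd : (q - q⁻¹) * qNumber q d = q ^ d - (q ^ d)⁻¹ := mul_div_cancel₀ _ h
    have h0 : f (a + 1) d 0 = (q ^ d)⁻¹ * f a d 0 := by
      simp only [hf, qBinomial_zero_right]
      rw [show -((((a + 1 : ℕ) : ℤ) - (0 : ℕ)) * ((d : ℤ) - (0 : ℕ)))
          = -(d : ℤ) + -(((a : ℤ) - (0 : ℕ)) * ((d : ℤ) - (0 : ℕ))) by push_cast; ring,
        zpow_add₀ hq, zpow_neg, zpow_natCast]
      ring
    have h1 : ∀ r, f (a + 1) d (r + 1)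
        = (q ^ d)⁻¹ * f a d (r + 1) + (q ^ d - (q ^ d)⁻¹) * q ^ a * f a (d - 1) r := by
      intro r
      rw [← hd]
      rcases d with _ | d
      · simp [hf, qFalling_eq_zero, qNumber_zero]
      · have htri : (r + 1) * r / 2 = r * (r - 1) / 2 + r := Nat.triangle_succ r
        simp only [hf, qBinomial, htri, qFalling_succ_right' (d + 1),
          Nat.add_sub_cancel]
        rw [show -((((a + 1 : ℕ) : ℤ) - (r + 1 : ℕ)) * (((d + 1 : ℕ) : ℤ) - (r + 1 : ℕ)))
            = -(((a : ℤ) - r) * ((d : ℤ) - r)) by push_cast; ring,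
          show -(((a : ℤ) - (r + 1 : ℕ)) * (((d + 1 : ℕ) : ℤ) - (r + 1 : ℕ)))
            = ((d : ℤ) - r) + -(((a : ℤ) - r) * ((d : ℤ) - r)) by push_cast; ring,
          zpow_add₀ hq, zpow_sub₀ hq, zpow_natCast, zpow_natCast]
        have := pow_ne_zero r hq
        have := pow_ne_zero d hq
        generalize q ^ (-(((a : ℤ) - r) * ((d : ℤ) - r))) = Z
        rw [pow_add q (r * (r - 1) / 2) r, pow_succ (q - q⁻¹), pow_succ q r, pow_succ q d]
        generalize q - q⁻¹ = u
        field_simp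
    have h2 : ∑ r ∈ Finset.range (a + 1 + 1), f a d r = q ^ (a * d) := by
      rw [Finset.sum_range_succ, ← ih d, add_eq_left]
      simp [hf, qBinomial_eq_zero]
    calc ∑ r ∈ Finset.range (a + 1 + 1), f (a + 1) d r
      _ = (q ^ d)⁻¹ * ∑ r ∈ Finset.range (a + 1 + 1), f a d r
          + (q ^ d - (q ^ d)⁻¹) * q ^ a * ∑ r ∈ Finset.range (a + 1), f a (d - 1) r := by
        rw [Finset.sum_range_succ', Finset.sum_range_succ' (f a d), h0,
          Finset.sum_congr rfl fun r _ => h1 r, Finset.sum_add_distrib, ← Finset.mul_sum,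
          ← Finset.mul_sum]
        ring
      _ = q ^ ((a + 1) * d) := by
        rw [h2, ih (d - 1)]
        rcases d with _ | d
        · simp
        · have := pow_ne_zero d hq
          simp only [Nat.add_sub_cancel]
          field_simp
          ring

end qBinomial

/-! ### The operator of the R-matrix -/

namespace QuantumPlane

section

variable {k : Type*} [Field k] {q : k}

/-- The action of the R-matrix on the tensor square of the quantum plane, given on the tensor
products of two monomials. -/
noncomputable def rMatrix (q s : k) :
    Module.End k (QuantumPlane k q ⊗[k] QuantumPlane k q) :=
  ((basis k q).tensorProduct (basis k q)).constr k fun p =>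
    ∑ r ∈ Finset.range (p.1.1 + 1),
      (rMatrixCoeff q r * s ^ ((((p.1.2 : ℤ) - p.1.1) + 2 * r) * (((p.2.2 : ℤ) - p.2.1) - 2 * r)) *
        (qFalling q p.1.1 r * qFalling q p.2.2 r)) •
        (monomial k q (p.1.1 - r, p.1.2 + r) ⊗ₜ[k] monomial k q (p.2.1 + r, p.2.2 - r))

theorem rMatrix_monomial (s : k) (a b c d : ℕ) :
    rMatrix q s (monomial k q (a, b) ⊗ₜ[k] monomial k q (c, d))
      = ∑ r ∈ Finset.range (a + 1),
        (rMatrixCoeff q r * s ^ ((((b : ℤ) - a) + 2 * r) * (((d : ℤ) - c) - 2 * r)) *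
          (qFalling q a r * qFalling q d r)) •
          (monomial k q (a - r, b + r) ⊗ₜ[k] monomial k q (c + r, d - r)) := by
  have h := ((basis k q).tensorProduct (basis k q)).constr_basis k (fun p =>
    ∑ r ∈ Finset.range (p.1.1 + 1),
      (rMatrixCoeff q r * s ^ ((((p.1.2 : ℤ) - p.1.1) + 2 * r) * (((p.2.2 : ℤ) - p.2.1) - 2 * r)) *
        (qFalling q p.1.1 r * qFalling q p.2.2 r)) •
        (monomial k q (p.1.1 - r, p.1.2 + r) ⊗ₜ[k] monomial k q (p.2.1 + r, p.2.2 - r)))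
    ((a, b), (c, d))
  rw [Module.Basis.tensorProduct_apply, basis_apply, basis_apply] at h
  exact h

theorem bijective_rMatrix {s : k} (hs0 : s ≠ 0) : Function.Bijective (rMatrix q s) := by
  refine ((basis k q).tensorProduct (basis k q)).bijective_of_triangular (fun p => p.1.1) _
    (fun p => s ^ (((p.1.2 : ℤ) - p.1.1) * ((p.2.2 : ℤ) - p.2.1)))
    (fun p => zpow_ne_zero _ hs0) ?_
  rintro ⟨⟨a, b⟩, ⟨c, d⟩⟩
  rw [Module.Basis.tensorProduct_apply, basis_apply, basis_apply, rMatrix_monomial,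
    Finset.sum_range_succ', add_sub_assoc]
  have h0 : rMatrixCoeff q 0 = 1 := by simp [rMatrixCoeff, qFactorial]
  have h1 : ∀ a : ℕ, qFalling q a 0 = 1 := by simp [qFalling]
  refine Submodule.add_mem _ (Submodule.sum_mem _ fun r hr => Submodule.smul_mem _ _
    (Submodule.subset_span ⟨((a - (r + 1), b + (r + 1)), (c + (r + 1), d - (r + 1))), ?_, ?_⟩)) ?_
  · rw [Finset.mem_range] at hr
    change a - (r + 1) < a
    omega
  · simp
  · simp [h0, h1]

variable (hq : q ≠ 0) (hq2 : q ^ 2 ≠ 1)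

theorem isRMatrixAction_rMatrix (s : k) :
    IsRMatrixAction s (action hq hq2) (weightPart k q) (action hq hq2) (weightPart k q)
      (rMatrix q s) := by
  intro i j m hm n hn L hL
  -- For `L` large, the partial sum of the R-matrix on vectors of weight `(i, j)` is a bilinear
  -- map whose values at fixed vectors do not depend on `L`.
  let θ : ℕ → Module.End k (QuantumPlane k q ⊗[k] QuantumPlane k q) := fun L =>
    ∑ r ∈ Finset.range L, (rMatrixCoeff q r * s ^ ((i + 2 * r) * (j - 2 * r))) •
      TensorProduct.map (action hq hq2 (Uq.E k q ^ r)) (action hq hq2 (Uq.F k q ^ r))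
  have hθ : ∀ (m n : QuantumPlane k q) (L : ℕ), θ L (m ⊗ₜ[k] n) = ∑ r ∈ Finset.range L,
      (rMatrixCoeff q r * s ^ ((i + 2 * r) * (j - 2 * r))) •
        (action hq hq2 (Uq.E k q ^ r) m ⊗ₜ[k] action hq hq2 (Uq.F k q ^ r) n) := by
    intro m n L
    simp [θ, LinearMap.sum_apply]
  have hstab : ∀ (m n : QuantumPlane k q) (L L' : ℕ), L ≤ L' →
      action hq hq2 (Uq.E k q ^ L) m = 0 → θ L' (m ⊗ₜ[k] n) = θ L (m ⊗ₜ[k] n) := by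
    intro m n L L' hLL' h0
    rw [hθ, hθ]
    refine (Finset.sum_subset (Finset.range_mono hLL') fun r _ hr => ?_).symm
    rw [Finset.mem_range, not_lt] at hr
    rw [← Nat.sub_add_cancel hr, pow_add (Uq.E k q), map_mul, Module.End.mul_apply, h0, map_zero,
      TensorProduct.zero_tmul, smul_zero]
  have hbasis : ∀ a b c d L : ℕ, (b : ℤ) - a = i → (d : ℤ) - c = j → a + 1 ≤ L →
      rMatrix q s (monomial k q (a, b) ⊗ₜ[k] monomial k q (c, d))
        = θ L (monomial k q (a, b) ⊗ₜ[k] monomial k q (c, d)) := by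
    rintro a b c d L rfl rfl hL
    rw [hstab _ _ (a + 1) L hL (by
      rw [action_E_pow_monomial, qFalling_eq_zero q (Nat.lt_succ_self _), zero_smul]),
      rMatrix_monomial, hθ]
    refine Finset.sum_congr rfl fun r _ => ?_
    rw [action_E_pow_monomial, action_F_pow_monomial, TensorProduct.smul_tmul_smul, smul_smul]
  have hmono : ∀ a b : ℕ, (b : ℤ) - a = i → ∃ L₀, ∀ L, L₀ ≤ L → ∀ n ∈ weightPart k q j,
      rMatrix q s (monomial k q (a, b) ⊗ₜ[k] n) = θ L (monomial k q (a, b) ⊗ₜ[k] n) := by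
    intro a b hab
    refine ⟨a + 1, fun L hL => ?_⟩
    suffices h : weightPart k q j ≤ LinearMap.eqLocus
        (rMatrix q s ∘ₗ TensorProduct.mk k _ _ (monomial k q (a, b)))
        (θ L ∘ₗ TensorProduct.mk k _ _ (monomial k q (a, b))) from fun n hn => h hn
    rw [weightPart_eq_span hq, Submodule.span_le]
    rintro _ ⟨⟨c, d⟩, hcd, rfl⟩
    exact hbasis a b c d L hab hcd hL
  have hall : ∃ L₀, ∀ L, L₀ ≤ L → ∀ n ∈ weightPart k q j,
      rMatrix q s (m ⊗ₜ[k] n) = θ L (m ⊗ₜ[k] n) := by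
    rw [weightPart_eq_span hq i] at hm
    clear hL
    induction hm using Submodule.span_induction with
    | mem u hu =>
      obtain ⟨⟨a, b⟩, hab, rfl⟩ := hu
      exact hmono a b hab
    | zero => exact ⟨0, fun L _ n _ => by simp⟩
    | add u v _ _ hu hv =>
      obtain ⟨L₁, h1⟩ := hu
      obtain ⟨L₂, h2⟩ := hv
      refine ⟨max L₁ L₂, fun L hL n hn => ?_⟩
      rw [TensorProduct.add_tmul, map_add, map_add, h1 L ((le_max_left _ _).trans hL) n hn,
        h2 L ((le_max_right _ _).trans hL) n hn]
    | smul c u _ hu =>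
      obtain ⟨L₀, h0⟩ := hu
      refine ⟨L₀, fun L hL n hn => ?_⟩
      rw [← TensorProduct.smul_tmul', map_smul, map_smul, h0 L hL n hn]
  obtain ⟨L₀, h0⟩ := hall
  rw [h0 (max L L₀) (le_max_right _ _) n hn, hstab m n L _ (le_max_left _ _) hL, hθ]

theorem eq_of_isRMatrixAction {s : k}
    {T T' : QuantumPlane k q ⊗[k] QuantumPlane k q →ₗ[k] QuantumPlane k q ⊗[k] QuantumPlane k q}
    (h : IsRMatrixAction s (action hq hq2) (weightPart k q) (action hq hq2) (weightPart k q) T)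
    (h' : IsRMatrixAction s (action hq hq2) (weightPart k q) (action hq hq2) (weightPart k q) T') :
    T' = T := by
  refine TensorProduct.ext (bilin_ext_monomial fun a b c d => ?_)
  have h0 : action hq hq2 (Uq.E k q ^ (a + 1)) (monomial k q (a, b)) = 0 := by
    rw [action_E_pow_monomial, qFalling_eq_zero q (Nat.lt_succ_self _), zero_smul]
  exact (h' _ _ _ (monomial_mem_weightPart hq a b) _ (monomial_mem_weightPart hq c d) _ h0).trans
    (h _ _ _ (monomial_mem_weightPart hq a b) _ (monomial_mem_weightPart hq c d) _ h0).symm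

end

end QuantumPlane

/-! ### The twisted product -/

namespace QuantumPlane

section

variable {k : Type*} [Field k] {q : k}

/-- The exponent `(i ^ 2 - n) / 2` of `s` by which the monomial of weight `i = b - a` and degree
`n = a + b` is rescaled. The division is exact. -/
def rescaleExp (a b : ℕ) : ℤ := (((b : ℤ) - a) ^ 2 - (a + b)) / 2

theorem two_mul_rescaleExp (a b : ℕ) : 2 * rescaleExp a b = ((b : ℤ) - a) ^ 2 - (a + b) := by
  apply Int.mul_ediv_cancel'
  obtain ⟨c, hc⟩ := (Int.even_mul_pred_self ((b : ℤ) - a)).two_dvd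
  exact ⟨c - a, by linear_combination hc⟩

/-- The rescaling turns the Cartan part `s ^ (i j)` of the R-matrix into a coboundary. -/
theorem rescaleExp_add (a b c d : ℕ) :
    rescaleExp (a + c) (b + d)
      = ((b : ℤ) - a) * ((d : ℤ) - c) + rescaleExp a b + rescaleExp c d := by
  have h1 := two_mul_rescaleExp (a + c) (b + d)
  have h2 := two_mul_rescaleExp a b
  have h3 := two_mul_rescaleExp c d
  push_cast at h1
  have h : 2 * rescaleExp (a + c) (b + d)
      = 2 * (((b : ℤ) - a) * ((d : ℤ) - c) + rescaleExp a b + rescaleExp c d) := by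
    linear_combination h1 - h2 - h3
  omega

/-- The linear isomorphism from the `q`-plane to the `q⁻¹`-plane that rescales the monomials
`y ^ b x ^ a`. -/
noncomputable def rescale (q : k) {s : k} (hs0 : s ≠ 0) :
    QuantumPlane k q ≃ₗ[k] QuantumPlane k q⁻¹ :=
  (basis k q).equiv
    ((basis k q⁻¹).unitsSMul fun p => Units.mk0 (s ^ rescaleExp p.1 p.2) (zpow_ne_zero _ hs0))
    (Equiv.refl _)

variable {s : k} (hs0 : s ≠ 0)

theorem rescale_monomial (a b : ℕ) :
    rescale q hs0 (monomial k q (a, b)) = s ^ rescaleExp a b • monomial k q⁻¹ (a, b) := by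
  rw [← basis_apply, rescale, Module.Basis.equiv_apply]
  simp [Module.Basis.unitsSMul_apply, Units.smul_def]

theorem rescale_one : rescale q hs0 1 = 1 := by
  rw [← monomial_zero, rescale_monomial, monomial_zero]
  simp [rescaleExp]

theorem rescale_x : rescale q hs0 (x k q) = x k q⁻¹ := by
  rw [← monomial_x, rescale_monomial, monomial_x]
  simp [rescaleExp]

theorem rescale_y : rescale q hs0 (y k q) = y k q⁻¹ := by
  rw [← monomial_y, rescale_monomial, monomial_y]
  simp [rescaleExp]

/-- Up to the rescaling of monomials, the product of the `q`-plane is the product of the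
`q⁻¹`-plane composed with the R-matrix. -/
theorem rescale_mul' (hq : q ≠ 0) (hq2 : q ^ 2 ≠ 1)
    (u : QuantumPlane k q ⊗[k] QuantumPlane k q) :
    rescale q hs0 (LinearMap.mul' k _ u)
      = LinearMap.mul' k _ (TensorProduct.map (rescale q hs0).toLinearMap
          (rescale q hs0).toLinearMap (rMatrix q s u)) := by
  suffices h : (rescale q hs0).toLinearMap ∘ₗ LinearMap.mul' k _
      = LinearMap.mul' k _ ∘ₗ TensorProduct.map (rescale q hs0).toLinearMap
          (rescale q hs0).toLinearMap ∘ₗ rMatrix q s from LinearMap.congr_fun h u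
  refine TensorProduct.ext (bilin_ext_monomial fun a b c d => ?_)
  have hterm : ∀ r, LinearMap.mul' k (QuantumPlane k q⁻¹)
      (TensorProduct.map (rescale q hs0).toLinearMap (rescale q hs0).toLinearMap
        ((rMatrixCoeff q r * s ^ ((((b : ℤ) - a) + 2 * r) * (((d : ℤ) - c) - 2 * r)) *
          (qFalling q a r * qFalling q d r)) •
          (monomial k q (a - r, b + r) ⊗ₜ[k] monomial k q (c + r, d - r))))
      = (q ^ (r * (r - 1) / 2) * (q - q⁻¹) ^ r * qBinomial q a r * qFalling q d r
        * q ^ (-(((a : ℤ) - r) * ((d : ℤ) - r)))) •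
        (s ^ rescaleExp (a + c) (b + d) • monomial k q⁻¹ (a + c, b + d)) := by
    intro r
    -- For `r > a` or `r > d`, where the exponents are truncated, both sides vanish.
    rcases lt_or_ge a r with ha | ha
    · rw [qFalling_eq_zero q ha, qBinomial_eq_zero ha]
      simp
    rcases lt_or_ge d r with hd | hd
    · rw [qFalling_eq_zero q hd]
      simp
    have h1 : a - r + (c + r) = a + c := by omega
    have h2 : b + r + (d - r) = b + d := by omega
    have hexp := rescaleExp_add (a - r) (b + r) (c + r) (d - r)
    rw [h1, h2] at hexp
    push_cast [Nat.cast_sub ha, Nat.cast_sub hd] at hexp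
    rw [show ((b : ℤ) + r - (a - r)) * (d - r - (c + r))
      = (((b : ℤ) - a) + 2 * r) * (((d : ℤ) - c) - 2 * r) by ring] at hexp
    rw [hexp, zpow_add₀ hs0, zpow_add₀ hs0, map_smul, map_smul, TensorProduct.map_tmul,
      LinearMap.mul'_apply, LinearEquiv.coe_coe, rescale_monomial, rescale_monomial,
      smul_mul_smul_comm, monomial_mul, h1, h2, smul_smul, smul_smul, smul_smul,
      ← rMatrixCoeff_mul_qFalling hq]
    congr 1
    rw [inv_pow, zpow_neg, ← Nat.cast_sub ha, ← Nat.cast_sub hd, ← Nat.cast_mul, zpow_natCast]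
    ring
  change rescale q hs0 (monomial k q (a, b) * monomial k q (c, d))
    = LinearMap.mul' k _ (TensorProduct.map (rescale q hs0).toLinearMap
      (rescale q hs0).toLinearMap (rMatrix q s (monomial k q (a, b) ⊗ₜ[k] monomial k q (c, d))))
  simp only [rMatrix_monomial, map_sum, hterm]
  rw [← Finset.sum_smul, sum_qBinomial_mul_qFalling hq (sub_inv_ne_zero_of_sq_ne_one hq hq2),
    monomial_mul, map_smul, rescale_monomial]

/-- The action of the R-matrix as an invertible operator. -/
noncomputable def rMatrixEquiv (q : k) {s : k} (hs0 : s ≠ 0) :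
    (QuantumPlane k q ⊗[k] QuantumPlane k q) ≃ₗ[k] (QuantumPlane k q ⊗[k] QuantumPlane k q) :=
  LinearEquiv.ofBijective (rMatrix q s) (bijective_rMatrix hs0)

theorem rMatrixEquiv_toLinearMap : (rMatrixEquiv q hs0).toLinearMap = rMatrix q s := rfl

theorem rescale_twistMul (hq : q ≠ 0) (hq2 : q ^ 2 ≠ 1) (a b : QuantumPlane k q) :
    rescale q hs0 (twistMul (rMatrixEquiv q hs0) a b) = rescale q hs0 a * rescale q hs0 b := by
  rw [twistMul, rescale_mul' hs0 hq hq2, ← rMatrixEquiv_toLinearMap hs0, LinearEquiv.coe_coe,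
    LinearEquiv.apply_symm_apply, TensorProduct.map_tmul, LinearMap.mul'_apply,
    LinearEquiv.coe_coe]

theorem isTwisting_rMatrixEquiv (hq : q ≠ 0) (hq2 : q ^ 2 ≠ 1) :
    IsTwisting (rMatrixEquiv q hs0) where
  assoc a b c := (rescale q hs0).injective (by simp only [rescale_twistMul hs0 hq hq2, mul_assoc])
  one_mul a := (rescale q hs0).injective (by
    rw [rescale_twistMul hs0 hq hq2, rescale_one, one_mul])
  mul_one a := (rescale q hs0).injective (by
    rw [rescale_twistMul hs0 hq hq2, rescale_one, mul_one])

/-- The Drinfeld twist of the `q`-plane by the R-matrix is the `q⁻¹`-plane. -/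
noncomputable def twistEquiv (hq : q ≠ 0) (hq2 : q ^ 2 ≠ 1) :
    DrinfeldTwist (rMatrixEquiv q hs0) (isTwisting_rMatrixEquiv hs0 hq hq2)
      ≃ₐ[k] QuantumPlane k q⁻¹ :=
  AlgEquiv.ofLinearEquiv
    ((DrinfeldTwist.of _ (isTwisting_rMatrixEquiv hs0 hq hq2)).symm ≪≫ₗ rescale q hs0)
    (rescale_one hs0) (fun a b => rescale_twistMul hs0 hq hq2 a b)

theorem twistEquiv_of (hq : q ≠ 0) (hq2 : q ^ 2 ≠ 1) (a : QuantumPlane k q) :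
    twistEquiv hs0 hq hq2 (DrinfeldTwist.of _ (isTwisting_rMatrixEquiv hs0 hq hq2) a)
      = rescale q hs0 a := rfl

theorem map_rescale_degreePart (n : ℕ) :
    (degreePart k q n).map (rescale q hs0).toLinearMap = degreePart k q⁻¹ n := by
  rw [degreePart_eq_span, degreePart_eq_span]
  apply le_antisymm
  · rw [Submodule.map_span_le]
    rintro _ ⟨⟨a, b⟩, h, rfl⟩
    rw [LinearEquiv.coe_coe, rescale_monomial]
    exact Submodule.smul_mem _ _ (Submodule.subset_span ⟨_, h, rfl⟩)
  · rw [Submodule.span_le]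
    rintro _ ⟨⟨a, b⟩, h, rfl⟩
    refine ⟨(s ^ rescaleExp a b)⁻¹ • monomial k q (a, b),
      Submodule.smul_mem _ _ (Submodule.subset_span ⟨_, h, rfl⟩), ?_⟩
    rw [LinearEquiv.coe_coe, map_smul, rescale_monomial, smul_smul,
      inv_mul_cancel₀ (zpow_ne_zero _ hs0), one_smul]

end

end QuantumPlane

/-! ### Quadraticity of quantum planes -/

namespace QuantumPlane

section

variable {k : Type*} [Field k] {p : k}

theorem finiteDimensional_degreePart (n : ℕ) : FiniteDimensional k (degreePart k p n) := by
  rw [degreePart_eq_span]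
  refine FiniteDimensional.span_of_finite k (Set.Finite.image _ ?_)
  refine (Set.finite_Iic (n, n)).subset fun p (hp : p.1 + p.2 = n) => ?_
  exact ⟨by simp; omega, by simp; omega⟩

instance instNontrivial : Nontrivial (QuantumPlane k p) :=
  (basis k p).repr.toEquiv.nontrivial

/-- An algebra isomorphic to a quantum plane is quadratic for the transported grading. The kernel
of the map from the tensor algebra is generated by
`x ⊗ y - p y ⊗ x`: modulo this element, the images of `x` and `y` satisfy the relation of the
quantum plane, which gives a left inverse of the map from the quotient of the tensor algebra. -/
theorem isQuadraticAlgebra_of_algEquiv {A : Type*} [Ring A] [Algebra k A]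
    (e : QuantumPlane k p ≃ₐ[k] A) {𝒜 : ℕ → Submodule k A}
    (h𝒜 : ∀ n, 𝒜 n = (degreePart k p n).map e.toLinearMap) : IsQuadraticAlgebra k 𝒜 := by
  have hspan : 𝒜 1 = Submodule.span k {e (x k p), e (y k p)} := by
    rw [h𝒜, degreePart, pow_one, Submodule.map_span, Set.image_pair]
    rfl
  have hpow : ∀ n, 𝒜 n = 𝒜 1 ^ n := by
    intro n
    rw [h𝒜, h𝒜, degreePart, degreePart, pow_one]
    exact Submodule.map_pow _ e.toAlgHom n
  have hx1 : e (x k p) ∈ 𝒜 1 := hspan ▸ Submodule.subset_span (by simp)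
  have hy1 : e (y k p) ∈ 𝒜 1 := hspan ▸ Submodule.subset_span (by simp)
  let X : TensorAlgebra k (𝒜 1) := TensorAlgebra.ι k ⟨_, hx1⟩
  let Y : TensorAlgebra k (𝒜 1) := TensorAlgebra.ι k ⟨_, hy1⟩
  refine ⟨e.symm.toEquiv.nontrivial, ?_, ?_, ?_, ?_, ?_, ?_⟩
  · rw [hpow, pow_zero]
  · intro i j a b ha hb
    rw [hpow] at ha hb ⊢
    rw [pow_add]
    exact Submodule.mul_mem_mul ha hb
  · have h𝒜' : 𝒜 = fun n => Submodule.span k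
        ((basis k p).map e.toLinearEquiv '' {p | p.1 + p.2 = n}) := by
      funext n
      rw [h𝒜, degreePart_eq_span, Submodule.map_span, Set.image_image]
      congr 2
      funext p
      rw [Module.Basis.map_apply, basis_apply]
      rfl
    rw [h𝒜']
    exact Module.Basis.isInternal_span_image _ fun p : ℕ × ℕ => p.1 + p.2
  · intro n
    rw [h𝒜]
    have := finiteDimensional_degreePart (k := k) (p := p) n
    infer_instance
  · intro a
    obtain ⟨u, rfl⟩ := e.surjective a
    induction u using QuantumPlane.induction with
    | hc c => exact ⟨algebraMap k _ c, by simp⟩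
    | hx => exact ⟨X, by simp [X]⟩
    | hy => exact ⟨Y, by simp [Y]⟩
    | hm a b ha hb =>
      obtain ⟨u, hu⟩ := ha
      obtain ⟨v, hv⟩ := hb
      exact ⟨u * v, by rw [map_mul, hu, hv, map_mul]⟩
    | ha a b ha hb =>
      obtain ⟨u, hu⟩ := ha
      obtain ⟨v, hv⟩ := hb
      exact ⟨u + v, by rw [map_add, hu, hv, map_add]⟩
  · refine ⟨Submodule.span k {X * Y - p • (Y * X)}, ?_, fun t => ⟨fun ht => ?_, fun ht => ?_⟩⟩
    · rw [Submodule.span_singleton_le_iff_mem, sq]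
      exact Submodule.sub_mem _ (Submodule.mul_mem_mul ⟨_, rfl⟩ ⟨_, rfl⟩)
        (Submodule.smul_mem _ _ (Submodule.mul_mem_mul ⟨_, rfl⟩ ⟨_, rfl⟩))
    · set I := TwoSidedIdeal.span
        ((Submodule.span k {X * Y - p • (Y * X)} : Submodule k (TensorAlgebra k (𝒜 1))) :
          Set (TensorAlgebra k (𝒜 1)))
      let π : TensorAlgebra k (𝒜 1) →ₐ[k] I.ringCon.Quotient := I.ringCon.mkₐ k
      have hπ : ∀ t, π t = 0 ↔ t ∈ I := fun t =>
        I.ringCon.eq.trans (I.mem_iff t).symm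
      have hrel : π X * π Y = p • (π Y * π X) := by
        rw [← sub_eq_zero, ← map_mul π, ← map_mul π, ← map_smul π, ← map_sub π, hπ]
        exact TwoSidedIdeal.subset_span (Submodule.mem_span_singleton_self _)
      have hcomp : ((lift _ _ hrel).comp e.symm.toAlgHom).comp
          (TensorAlgebra.lift k (𝒜 1).subtype) = π := by
        apply TensorAlgebra.hom_ext
        ext ⟨v, hv⟩
        have hv' := hv
        rw [hspan, Submodule.mem_span_pair] at hv'
        obtain ⟨α, β, rfl⟩ := hv'
        have hι : (⟨_, hv⟩ : 𝒜 1) = α • ⟨_, hx1⟩ + β • ⟨_, hy1⟩ := rfl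
        simp only [hι, map_add, map_smul]
        simp [X, Y]
      rw [← hπ, ← hcomp, AlgHom.comp_apply, ht, map_zero]
    · have hle : TwoSidedIdeal.span
          ((Submodule.span k {X * Y - p • (Y * X)} : Submodule k (TensorAlgebra k (𝒜 1))) :
            Set (TensorAlgebra k (𝒜 1)))
          ≤ TwoSidedIdeal.ker (TensorAlgebra.lift k (𝒜 1).subtype) := by
        rw [TwoSidedIdeal.span_le]
        intro t ht
        obtain ⟨c, rfl⟩ := Submodule.mem_span_singleton.1 ht
        rw [SetLike.mem_coe, TwoSidedIdeal.mem_ker, map_smul, map_sub, map_smul, map_mul, map_mul]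
        simp only [X, Y, TensorAlgebra.lift_ι_apply, Submodule.subtype_apply]
        rw [← map_mul, ← map_mul, x_mul_y, map_smul, sub_self, smul_zero]
      exact (TwoSidedIdeal.mem_ker _).1 (hle ht)

end

end QuantumPlane

theorem mainTheorem3 {k : Type*} [Field k] (q s : k) (hq : q ≠ 0) (hq2 : q ^ 2 ≠ 1)
    (hs : s ^ 2 = q) :
    ∃ ρ : Uq k q →ₐ[k] Module.End k (QuantumPlane k q),
      (IsPlaneAction ρ ∧ ∀ ρ', IsPlaneAction ρ' → ρ' = ρ) ∧
      (∀ (h : Uq k q) (n : ℕ), ∀ a ∈ QuantumPlane.degreePart k q n,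
        ρ h a ∈ QuantumPlane.degreePart k q n) ∧
      IsLocallyNilpotent ρ ∧
      IsWeightDecomposition ρ (QuantumPlane.weightPart k q) ∧
      ∃ T : (QuantumPlane k q ⊗[k] QuantumPlane k q) ≃ₗ[k]
          (QuantumPlane k q ⊗[k] QuantumPlane k q),
        (IsRMatrixAction s ρ (QuantumPlane.weightPart k q) ρ (QuantumPlane.weightPart k q)
            T.toLinearMap ∧
          ∀ T', IsRMatrixAction s ρ (QuantumPlane.weightPart k q) ρ
            (QuantumPlane.weightPart k q) T' → T' = T.toLinearMap) ∧
        ∃ hT : IsTwisting T,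
          IsQuadraticAlgebra k (fun n =>
            (QuantumPlane.degreePart k q n).map (DrinfeldTwist.of T hT).toLinearMap) ∧
          ∃ φ : DrinfeldTwist T hT ≃ₐ[k] QuantumPlane k q⁻¹,
            φ (DrinfeldTwist.of T hT (QuantumPlane.x k q)) = QuantumPlane.x k q⁻¹ ∧
            φ (DrinfeldTwist.of T hT (QuantumPlane.y k q)) = QuantumPlane.y k q⁻¹ := by
  have hs0 : s ≠ 0 := by
    rintro rfl
    exact hq (by rw [← hs, zero_pow two_ne_zero])
  have hR := QuantumPlane.isRMatrixAction_rMatrix hq hq2 s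
  refine ⟨QuantumPlane.action hq hq2,
    ⟨QuantumPlane.isPlaneAction_action hq hq2,
      fun ρ' h => (QuantumPlane.isPlaneAction_action hq hq2).unique h⟩,
    fun h n a ha => QuantumPlane.action_mem_degreePart hq hq2 h n ha,
    QuantumPlane.isLocallyNilpotent_action hq hq2,
    QuantumPlane.isWeightDecomposition_action hq hq2,
    QuantumPlane.rMatrixEquiv q hs0,
    ⟨hR, fun T' h => QuantumPlane.eq_of_isRMatrixAction hq hq2 hR h⟩,
    QuantumPlane.isTwisting_rMatrixEquiv hs0 hq hq2,
    QuantumPlane.isQuadraticAlgebra_of_algEquiv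
      (QuantumPlane.twistEquiv hs0 hq hq2).symm fun n => ?_,
    QuantumPlane.twistEquiv hs0 hq hq2,
    QuantumPlane.rescale_x hs0, QuantumPlane.rescale_y hs0⟩
  rw [← QuantumPlane.map_rescale_degreePart hs0, ← Submodule.map_comp]
  congr 1
  ext a
  simp [← QuantumPlane.twistEquiv_of hs0 hq hq2]
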